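/- For every integer $n\ge 1$ let $m=m(n)$ be an integer and $\overline p=\overline p(n)=(p_1,\dots,p_m)$ with all $p_i\in(0,1)$. In the random intersection graph $\mathcal G(n,m,\overline p)$ on $n$ vertices each vertex $v$ receives feature $i\in\{1,\dots,m\}$ with probability $p_i$, independently over all vertices and features, and two distinct vertices are adjacent if and only if they have a common feature. For $i\in\{2,3\}$ and $q\in[0,1]$ let $H_i(n,q)$ be the random $i$-uniform hypergraph on the same $n$ vertices in which each $i$-element set is a hyperedge independently with probability $q$, and let $G_i(n,q)$ be the graph in which two distinct vertices are adjacent if and only if some hyperedge of $H_i(n,q)$ contains both; thus $G(n,q):=G_2(n,q)$ is the binomial random graph. A parameter $q<0$ is read as $0$ and a parameter $q>1$ as $1$. In a union $G_2(n,q)\cup G_3(n,q')$ the two graphs are independent. Put $$S_1=\sum_{i=1}^m np_i\bigl(1-(1-p_i)^{n-1}\bigr),\qquad S_2=\sum_{i=1}^m np_i\Bigl(1-\frac{1-(1-2p_i)^n}{2np_i}\Bigr),$$ $$S_3=\sum_{i=1}^m np_i\Bigl(\frac{1-(1-2p_i)^n}{2np_i}-(1-p_i)^{n-1}\Bigr).$$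 Assume that $S_1\to\infty$ and $S_1=o(n^2)$ as $n\to\infty$, and let $\omega=\omega(n)$ be any function tending to infinity. Let $$\hat p=\frac{S_2-\omega\sqrt{S_2}-2S_2^2n^{-2}}{2\binom n2},$$ and let $\hat p_2,\hat p_3$ be defined in the following two cases: (a) if $\sqrt{S_1}=o(S_3)$ and $\omega^2=o(S_3/\sqrt{S_1})$, then $$\hat p_2=\frac{S_1-3S_3-\omega\sqrt{S_1}-2S_1^2n^{-2}}{2\binom n2},\qquad \hat p_3=\frac{S_3-\omega\sqrt{S_1}-6S_3^2n^{-3}}{\binom n3};$$ (b) if $S_3=O(\sqrt{S_1})$, then $$\hat p_2=\frac{S_1-\omega\sqrt{S_1}-2S_1^2n^{-2}}{2\binom n2},\qquad \hat p_3=0.$$ Then the following holds. 1. For every $n$ there is a coupling of $G(n,\hat p)$ and $\mathcal G(n,m,\overline p)$ (a pair of random graphs on one probability space with these two laws) such that the probability that the first graph is a subgraph of the second tends to $1$ as $n\to\infty$. Consequently, for every increasing graph property $\mathcal A$ (a family of graphs closed under isomorphism and, on a fixed vertex set, under the addition of edges), $$\liminf_{n\to\infty}\Pr\{G(n,\hat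 p)\in\mathcal A\}\le\limsup_{n\to\infty}\Pr\{\mathcal G(n,m,\overline p)\in\mathcal A\}.$$ 2. In each of the cases (a) and (b), for every $n$ there is a coupling of $G_2(n,\hat p_2)\cup G_3(n,\hat p_3)$ and $\mathcal G(n,m,\overline p)$ such that the probability that the first graph is a subgraph of the second tends to $1$ as $n\to\infty$. Consequently, for every increasing graph property $\mathcal A$, $$\liminf_{n\to\infty}\Pr\{G_2(n,\hat p_2)\cup G_3(n,\hat p_3)\in\mathcal A\}\le\limsup_{n\to\infty}\Pr\{\mathcal G(n,m,\overline p)\in\mathcal A\}.$$ -/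

import Mathlib

open MeasureTheory ProbabilityTheory Filter Topology Asymptotics

noncomputable section

namespace RIG

/-- The probability parameter given by a real number: the number itself if it lies in `[0, 1]`,
and otherwise the nearest end of `[0, 1]`. -/
def prob (x : ℝ) : unitInterval := Set.projIcc 0 1 zero_le_one x

/-! ### The random graph models -/

/-- The intersection graph in which `V i` is the set of the vertices that have feature `i`:
two distinct vertices are adjacent iff they share a feature. -/
def intersectionGraph {n m : ℕ} (V : Fin m → Set (Fin n)) : SimpleGraph (Fin n) where
  Adj v w := v ≠ w ∧ ∃ i, v ∈ V i ∧ w ∈ V i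
  symm := ⟨fun _ _ h => ⟨h.1.symm, h.2.imp fun _ hi => hi.symm⟩⟩
  loopless := ⟨fun _ h => h.1 rfl⟩

/-- The law of the random intersection graph `G(n, m, p)`: each vertex has feature `i` with
probability `p i`, independently over all vertices and features. -/
def intersectionLaw (n m : ℕ) (p : Fin m → ℝ) : Measure (SimpleGraph (Fin n)) :=
  (Measure.pi fun i : Fin m => setBernoulli (Set.univ : Set (Fin n)) (prob (p i))).map
    intersectionGraph

/-- The graph generated by a set of hyperedges: two distinct vertices are adjacent iff some
hyperedge contains both of them. -/
def hyperedgeGraph {n : ℕ} (E : Set (Finset (Fin n))) : SimpleGraph (Fin n) where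
  Adj v w := v ≠ w ∧ ∃ e ∈ E, v ∈ e ∧ w ∈ e
  symm := ⟨fun _ _ h => ⟨h.1.symm, h.2.imp fun _ he => ⟨he.1, he.2.symm⟩⟩⟩
  loopless := ⟨fun _ h => h.1 rfl⟩

/-- The law of the hyperedge set of `H_i(n, q)`: each `i`-element set of vertices is a hyperedge
with probability `q`, independently of the others. -/
def hypergraphLaw (i n : ℕ) (q : ℝ) : Measure (Set (Finset (Fin n))) :=
  setBernoulli {e : Finset (Fin n) | e.card = i} (prob q)

/-- The law of `G_i(n, q)`, the graph generated by `H_i(n, q)`; for `i = 2` it is the binomial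
random graph `G(n, q)`. -/
def graphLaw (i n : ℕ) (q : ℝ) : Measure (SimpleGraph (Fin n)) :=
  (hypergraphLaw i n q).map hyperedgeGraph

/-- The law of the union of independent `G_2(n, q₂)` and `G_3(n, q₃)`. -/
def unionLaw (n : ℕ) (q₂ q₃ : ℝ) : Measure (SimpleGraph (Fin n)) :=
  ((graphLaw 2 n q₂).prod (graphLaw 3 n q₃)).map fun G => G.1 ⊔ G.2

/-! ### The parameters -/

def S₁ (n m : ℕ) (p : Fin m → ℝ) : ℝ :=
  ∑ i, n * p i * (1 - (1 - p i) ^ (n - 1))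

def S₂ (n m : ℕ) (p : Fin m → ℝ) : ℝ :=
  ∑ i, n * p i * (1 - (1 - (1 - 2 * p i) ^ n) / (2 * n * p i))

def S₃ (n m : ℕ) (p : Fin m → ℝ) : ℝ :=
  ∑ i, n * p i * ((1 - (1 - 2 * p i) ^ n) / (2 * n * p i) - (1 - p i) ^ (n - 1))

/-- The number `(s - w √s - 2 s² / n²) / (2 binom(n, 2))`. It is the parameter of the coupled
binomial graph for `s = S₂`, and for `s = S₁` if `S₃ = O(√S₁)`. -/
def pHat (n : ℕ) (s w : ℝ) : ℝ :=
  (s - w * √s - 2 * s ^ 2 / n ^ 2) / (2 * n.choose 2)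

/-- The number `(s₁ - 3 s₃ - w √s₁ - 2 s₁² / n²) / (2 binom(n, 2))`. -/
def pHat₂ (n : ℕ) (s₁ s₃ w : ℝ) : ℝ :=
  (s₁ - 3 * s₃ - w * √s₁ - 2 * s₁ ^ 2 / n ^ 2) / (2 * n.choose 2)

/-- The number `(s₃ - w √s₁ - 6 s₃² / n³) / binom(n, 3)`. -/
def pHat₃ (n : ℕ) (s₁ s₃ w : ℝ) : ℝ :=
  (s₃ - w * √s₁ - 6 * s₃ ^ 2 / n ^ 3) / n.choose 3

/-! ### Couplings and increasing properties -/

/-- The random graphs with laws `μ n` and `ν n` can be coupled so that, with probability tending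
to one, the first is a subgraph of the second. -/
def CoupledWhp (μ ν : ∀ n : ℕ, Measure (SimpleGraph (Fin n))) : Prop :=
  ∃ π : ∀ n : ℕ, Measure (SimpleGraph (Fin n) × SimpleGraph (Fin n)),
    (∀ n, IsProbabilityMeasure (π n) ∧ (π n).map Prod.fst = μ n ∧ (π n).map Prod.snd = ν n) ∧
    Tendsto (fun n => π n {G | G.1 ≤ G.2}) atTop (𝓝 1)

/-- An increasing graph property: for each `n`, a family of graphs on `n` vertices that is closed
under isomorphism and under the addition of edges. -/
def IsIncreasingProperty (A : ∀ n : ℕ, Set (SimpleGraph (Fin n))) : Prop :=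
  ∀ n, (∀ G ∈ A n, ∀ H : SimpleGraph (Fin n), Nonempty (G ≃g H) → H ∈ A n) ∧
    ∀ G ∈ A n, ∀ H : SimpleGraph (Fin n), G ≤ H → H ∈ A n

/-- The conclusion of the coupling theorem for a sequence of laws `μ` below a sequence `ν`: a
coupling with containment with probability tending to one, and the comparison of the
probabilities of every increasing property. -/
def CouplingConclusion (μ ν : ∀ n : ℕ, Measure (SimpleGraph (Fin n))) : Prop :=
  CoupledWhp μ ν ∧
    ∀ A : ∀ n : ℕ, Set (SimpleGraph (Fin n)), IsIncreasingProperty A →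
      liminf (fun n => μ n (A n)) atTop ≤ limsup (fun n => ν n (A n)) atTop

end RIG

end

/-! Given its size `k`, the vertex set of a feature is uniform, and every pair inside it is an edge
of the intersection graph. So a feature of size `k` may spend its vertices on `f k` pairs and `z k`
triples that are independent and uniform over the whole vertex set, as long as `2 * f k + 3 * z k ≤
k`: they cover at most `k` vertices, and exchangeability lets the feature be placed over them. With
`f k = k / 2` the expected number of pairs is S₂/2. If each odd feature of size at least 3 trades a
pair for a triple, the expected numbers are (S₁ - 3S₃)/2 and S₃.

The distinct pairs and triples so obtained form exchangeable random families, and so do the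
hyperedges of H₂ and H₃. Such families can be coupled with inclusion as soon as their sizes compare.
The sizes are compared by Chebyshev: the number of hyperedges is binomial, the number of samples is
a sum over features whose variance is of the order of S₁ or S₂, and repetitions among l samples from
c sets cost at most about l²/(2c). This accounts for the terms ω√S and S²n⁻² (S²n⁻³ for triples) in
the parameters, and the failure probability is O(ω⁻²).

Both exchangeability arguments are instances of `exists_orbit_coupling`, and `exists_glued_coupling`
composes them. The counting is in `ncard_hypergraph_gt_card_image_le`. It rests on
`pi_uniformOn_card_image_lt_le` and on the Efron–Stein bound `variance_binomial_half_le`. -/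

namespace RIG

/-! ### Couplings on finite spaces -/

/-- With finitely many vertices this makes every set of graphs measurable, so measurability is
automatic from here on. -/
instance measurableSingletonClass_simpleGraph {V : Type*} [Countable V] :
    MeasurableSingletonClass (SimpleGraph V) where
  measurableSet_singleton G := by
    refine ⟨{G.Adj}, measurableSet_singleton _, ?_⟩
    ext H
    simp only [Set.mem_preimage, Set.mem_singleton_iff]
    exact SimpleGraph.ext_iff.symm

section Coupling

variable {X Y Z : Type*} [MeasurableSpace X] [MeasurableSpace Y] [MeasurableSpace Z]

/-- Two couplings that share a marginal can be glued along it. -/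
theorem exists_glued_coupling [Finite X] [Finite Y] [Finite Z]
    [DiscreteMeasurableSpace X] [DiscreteMeasurableSpace Y] [DiscreteMeasurableSpace Z]
    (π₁ : Measure (X × Z)) (π₂ : Measure (Z × Y)) [IsProbabilityMeasure π₁]
    [IsProbabilityMeasure π₂] (h : π₁.map Prod.snd = π₂.map Prod.fst) :
    ∃ τ : Measure ((X × Z) × Y), IsProbabilityMeasure τ ∧ τ.map Prod.fst = π₁ ∧
      τ.map (fun t => (t.1.2, t.2)) = π₂ := by
  have : Nonempty Y := ((inferInstance : NeZero π₂).out |> fun h0 => by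
    by_contra hY
    rw [not_nonempty_iff] at hY
    exact h0 (Measure.eq_zero_of_isEmpty _))
  -- Sample from `π₁`, then draw the `Y` coordinate from the conditional law of `π₂` given the
  -- shared `Z` coordinate.
  refine ⟨π₁ ⊗ₘ (π₂.condKernel.comap Prod.snd (by fun_prop)), inferInstance, ?_, ?_⟩
  · exact Measure.fst_compProd _ _
  · conv_rhs => rw [← π₂.disintegrate π₂.condKernel]
    ext s hs
    rw [Measure.map_apply (by fun_prop) hs, Measure.compProd_apply (MeasurableSet.of_discrete),
      Measure.compProd_apply hs, Measure.fst, ← h, lintegral_map (Measurable.of_discrete) (by fun_prop)]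
    rfl

/-- A joint law with marginals that are invariant under a finite group can be improved to a
coupling of the same marginals in which an invariant relation holds whenever it can be achieved by
moving the second coordinate within its orbit. -/
theorem exists_orbit_coupling {G : Type*} [Group G] [Finite G] [Finite X] [Finite Y]
    [DiscreteMeasurableSpace X] [DiscreteMeasurableSpace Y]
    (ρ : Measure (X × Y)) [IsProbabilityMeasure ρ] (a : G → X → X) (b : G → Y → Y)
    (hb : ∀ g h y, b (g * h) y = b g (b h y))
    (ha_inv : ∀ g, (ρ.map Prod.fst).map (a g) = ρ.map Prod.fst)
    (hb_inv : ∀ g, (ρ.map Prod.snd).map (b g) = ρ.map Prod.snd)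
    (R : X → Y → Prop) (hR : ∀ g x y, R x y → R (a g x) (b g y)) :
    ∃ π : Measure (X × Y), IsProbabilityMeasure π ∧ π.map Prod.fst = ρ.map Prod.fst ∧
      π.map Prod.snd = ρ.map Prod.snd ∧ ρ {t | ∃ g, R t.1 (b g t.2)} ≤ π {t | R t.1 t.2} := by
  classical
  let _ : MeasurableSpace G := ⊤
  have : DiscreteMeasurableSpace G := ⟨fun _ => trivial⟩
  have : Fintype G := Fintype.ofFinite G
  let U : Measure G := uniformOn Set.univ
  have : IsProbabilityMeasure U := isProbabilityMeasure_uniformOn Set.finite_univ Set.univ_nonempty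
  have hU (h : G) : U.map (· * h) = U := by
    refine Measure.ext_of_singleton fun g => ?_
    have hpre : (· * h) ⁻¹' ({g} : Set G) = {g * h⁻¹} := by
      ext; simp [eq_mul_inv_iff_mul_eq]
    rw [Measure.map_apply .of_discrete .of_discrete, hpre, uniformOn_univ, uniformOn_univ]
    simp
  let c : X × Y → G := fun t => if ht : ∃ g, R t.1 (b g t.2) then ht.choose else 1
  have hc (t : X × Y) (ht : ∃ g, R t.1 (b g t.2)) : R t.1 (b (c t) t.2) := by
    simp only [c, dif_pos ht]; exact ht.choose_spec
  -- The second coordinate is corrected by `c`, then a common uniform group element acts on both.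
  -- The relation survives because it is invariant, and the averaging repairs the second marginal
  -- that the correction may have spoiled.
  let φ : (X × Y) × G → X × Y := fun w => (a w.2 w.1.1, b w.2 (b (c w.1) w.1.2))
  refine ⟨(ρ.prod U).map φ, Measure.isProbabilityMeasure_map Measurable.of_discrete.aemeasurable, ?_,
    ?_, ?_⟩
  · ext s -
    rw [Measure.map_apply .of_discrete .of_discrete, Measure.map_apply .of_discrete .of_discrete,
      Measure.prod_apply_symm .of_discrete]
    have h1 (g : G) : ρ ((fun t => (t, g)) ⁻¹' (φ ⁻¹' (Prod.fst ⁻¹' s))) = ρ.map Prod.fst s := by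
      rw [← ha_inv g, Measure.map_apply .of_discrete .of_discrete,
        Measure.map_apply .of_discrete .of_discrete]
      rfl
    simp_rw [h1]
    simp
  · ext s -
    rw [Measure.map_apply .of_discrete .of_discrete, Measure.map_apply .of_discrete .of_discrete,
      Measure.prod_apply .of_discrete]
    -- For fixed `t` the product `g * c t` is again uniform, so the dependence on the correction
    -- disappears.
    have h1 (t : X × Y) : U (Prod.mk t ⁻¹' (φ ⁻¹' (Prod.snd ⁻¹' s))) = U {g | b g t.2 ∈ s} := by
      conv_rhs => rw [← hU (c t), Measure.map_apply .of_discrete .of_discrete]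
      congr 1
      ext g
      simp [φ, hb]
    simp_rw [h1]
    have h2 : ∫⁻ t, U {g | b g t.2 ∈ s} ∂ρ = (ρ.prod U) {w | b w.2 w.1.2 ∈ s} := by
      rw [Measure.prod_apply .of_discrete]; rfl
    rw [h2, Measure.prod_apply_symm .of_discrete]
    have h3 (g : G) : ρ ((fun t => (t, g)) ⁻¹' {w : (X × Y) × G | b w.2 w.1.2 ∈ s})
        = ρ.map Prod.snd s := by
      rw [← hb_inv g, Measure.map_apply .of_discrete .of_discrete,
        Measure.map_apply .of_discrete .of_discrete]
      rfl
    simp_rw [h3]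
    simp
  · rw [Measure.map_apply .of_discrete .of_discrete]
    calc ρ {t | ∃ g, R t.1 (b g t.2)}
        = (ρ.prod U) ({t | ∃ g, R t.1 (b g t.2)} ×ˢ Set.univ) := by simp
      _ ≤ _ := measure_mono fun w hw => hR _ _ _ (hc _ hw.1)

end Coupling

/-! ### Moments of functions of a binomial random variable -/

section Binomial

variable {n : ℕ} {p : unitInterval}

theorem integral_binomial_zero (p : unitInterval) (f : ℕ → ℝ) :
    ∫ k, f k ∂(binomial 0 p) = f 0 := by
  simp [binomial_zero]

/-- Adding one more trial. -/
theorem integral_binomial_succ (n : ℕ) (p : unitInterval) (f : ℕ → ℝ) :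
    ∫ k, f k ∂(binomial (n + 1) p) =
      ∫ k, ((1 - p : ℝ) * f k + p * f (k + 1)) ∂(binomial n p) := by
  have hI (n : ℕ) : Finset.Iic n = Finset.range (n + 1) := by
    ext; simp
  simp only [integral_binomial, smul_eq_mul, hI]
  rw [Finset.sum_range_succ']
  have h1 : ∀ k ∈ Finset.range (n + 1),
      ((n + 1).choose (k + 1) * (p : ℝ) ^ (k + 1) * (1 - p) ^ (n + 1 - (k + 1))) * f (k + 1) =
        n.choose k * (p : ℝ) ^ k * (1 - p) ^ (n - k) * (p * f (k + 1)) +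
        n.choose (k + 1) * (p : ℝ) ^ (k + 1) * (1 - p) ^ (n - k) * f (k + 1) := by
    intro k _
    rw [Nat.choose_succ_succ, Nat.add_sub_add_right]
    push_cast
    ring
  rw [Finset.sum_congr rfl h1, Finset.sum_add_distrib]
  simp only [mul_add]
  rw [Finset.sum_add_distrib, Finset.sum_range_succ' (fun k => _ * ((1 - (p : ℝ)) * f k)),
    Finset.sum_range_succ (fun k => _ * f (k + 1))]
  have h2 : ∀ k ∈ Finset.range n,
      n.choose (k + 1) * (p : ℝ) ^ (k + 1) * (1 - p) ^ (n - k) * f (k + 1) =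
        n.choose (k + 1) * (p : ℝ) ^ (k + 1) * (1 - p) ^ (n - (k + 1)) *
          ((1 - p) * f (k + 1)) := by
    intro k hk
    have : n - k = (n - (k + 1)) + 1 := by have := Finset.mem_range.1 hk; omega
    rw [this]
    ring
  rw [Finset.sum_congr rfl h2]
  simp
  ring

/-- The size-bias identity. It turns the factor `(n + 1) * p` of the Efron–Stein bound into a moment
that can be compared with the mean. -/
theorem integral_binomial_mul (n : ℕ) (p : unitInterval) (f : ℕ → ℝ) :
    ∫ k, (k : ℝ) * f k ∂(binomial (n + 1) p) =
      (n + 1) * p * ∫ k, f (k + 1) ∂(binomial n p) := by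
  induction n generalizing f with
  | zero =>
    rw [integral_binomial_succ, integral_binomial_zero, integral_binomial_zero]
    simp
  | succ n ih =>
    rw [integral_binomial_succ]
    have h1 (k : ℕ) : (1 - p : ℝ) * (k * f k) + p * ((k + 1 : ℕ) * f (k + 1)) =
        k * ((1 - p) * f k + p * f (k + 1)) + p * f (k + 1) := by
      push_cast; ring
    simp_rw [h1]
    rw [integral_add (integrable_binomial _) (integrable_binomial _), ih, integral_const_mul,
      integral_binomial_succ n p fun k => f (k + 1)]
    push_cast
    ring

theorem memLp_binomial (f : ℕ → ℝ) : MemLp f 2 (binomial n p) :=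
  (memLp_two_iff_integrable_sq (by fun_prop)).2 (integrable_binomial _)

theorem variance_binomial_eq (f : ℕ → ℝ) : Var[f; binomial n p] =
    ∫ k, f k ^ 2 ∂(binomial n p) - (∫ k, f k ∂(binomial n p)) ^ 2 := by
  rw [variance_eq_sub (memLp_binomial f)]; rfl

/-- The Efron–Stein inequality for functions of a binomial random variable. -/
theorem variance_binomial_succ_le (n : ℕ) (p : unitInterval) (f : ℕ → ℝ) :
    Var[f; binomial (n + 1) p] ≤
      (n + 1) * p * (1 - p) * ∫ k, (f (k + 1) - f k) ^ 2 ∂(binomial n p) := by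
  have hp0 : (0 : ℝ) ≤ p := p.2.1
  have hp1 : (0 : ℝ) ≤ 1 - p := sub_nonneg.2 p.2.2
  -- Law of total variance, conditioning on all trials but one.
  have step (n : ℕ) (f : ℕ → ℝ) : Var[f; binomial (n + 1) p] =
      Var[fun k => (1 - p : ℝ) * f k + p * f (k + 1); binomial n p] +
        p * (1 - p) * ∫ k, (f (k + 1) - f k) ^ 2 ∂(binomial n p) := by
    rw [variance_binomial_eq, variance_binomial_eq, integral_binomial_succ, integral_binomial_succ,
      ← integral_const_mul, sub_add_eq_add_sub, ← integral_add (integrable_binomial _)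
      (integrable_binomial _)]
    congr 2
    ext k
    ring
  induction n generalizing f with
  | zero =>
    rw [step, variance_binomial_eq, integral_binomial_zero, integral_binomial_zero,
      integral_binomial_zero]
    apply le_of_eq
    simp
  | succ n ih =>
    rw [step]
    have h1 := ih fun k => (1 - p : ℝ) * f k + p * f (k + 1)
    -- Jensen: an increment of the conditional mean is the average of two increments of `f`. The
    -- convexity gap is the product supplied to `nlinarith` below.
    have h2 : ∫ k, ((1 - p : ℝ) * f (k + 1) + p * f (k + 1 + 1) -
        ((1 - p) * f k + p * f (k + 1))) ^ 2 ∂(binomial n p) ≤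
        ∫ k, (f (k + 1) - f k) ^ 2 ∂(binomial (n + 1) p) := by
      rw [integral_binomial_succ]
      refine integral_mono (integrable_binomial _) (integrable_binomial _) fun k => ?_
      have := mul_nonneg (mul_nonneg hp0 hp1)
        (sq_nonneg ((f (k + 1) - f k) - (f (k + 1 + 1) - f (k + 1))))
      simp only
      nlinarith
    have h3 : 0 ≤ ((n : ℝ) + 1) * p * (1 - p : ℝ) := by positivity
    have h4 := mul_le_mul_of_nonneg_left h2 h3
    push_cast
    nlinarith

/-! ### Parity, pair counts and triple counts of a binomial variable -/

theorem integral_binomial_neg_one_pow (n : ℕ) (p : unitInterval) :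
    ∫ k, (-1 : ℝ) ^ k ∂(binomial n p) = (1 - 2 * p) ^ n := by
  induction n with
  | zero => simp [integral_binomial_zero]
  | succ n ih =>
    rw [integral_binomial_succ, pow_succ, ← ih, ← integral_mul_const]
    congr 1
    ext k
    ring

theorem integral_binomial_mod_two (n : ℕ) (p : unitInterval) :
    ∫ k, ((k % 2 : ℕ) : ℝ) ∂(binomial n p) = (1 - (1 - 2 * p) ^ n) / 2 := by
  rw [← integral_binomial_neg_one_pow]
  have h (k : ℕ) : ((k % 2 : ℕ) : ℝ) = (1 - (-1) ^ k) / 2 := by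
    rcases Nat.even_or_odd k with hk | hk
    · rw [hk.neg_one_pow, Nat.even_iff.1 hk]; norm_num
    · rw [hk.neg_one_pow, Nat.odd_iff.1 hk]; norm_num
  simp_rw [h]
  rw [integral_div, integral_sub (integrable_const _) (integrable_binomial _)]
  simp

theorem integral_binomial_id (n : ℕ) (p : unitInterval) :
    ∫ k, (k : ℝ) ∂(binomial n p) = n * p := by
  cases n with
  | zero => simp [integral_binomial_zero]
  | succ n => simpa using integral_binomial_mul n p fun _ => 1

theorem variance_binomial_id_le (n : ℕ) (p : unitInterval) :
    Var[fun k : ℕ => (k : ℝ); binomial n p] ≤ n * p := by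
  cases n with
  | zero => simp [binomial_zero]
  | succ n =>
    refine (variance_binomial_succ_le n p _).trans ?_
    have hp0 : (0 : ℝ) ≤ p := p.2.1
    have : (0 : ℝ) ≤ (n + 1) * p * p := by positivity
    simp
    nlinarith

/-- The number of pairs contained in a matching of a set of `k` points has mean at least half its
variance. -/
theorem variance_binomial_half_le (n : ℕ) (p : unitInterval) :
    Var[fun k : ℕ => ((k / 2 : ℕ) : ℝ); binomial n p] ≤
      2 * ∫ k, ((k / 2 : ℕ) : ℝ) ∂(binomial n p) := by
  have hp0 : (0 : ℝ) ≤ p := p.2.1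
  cases n with
  | zero => simp [binomial_zero]
  | succ n =>
    refine (variance_binomial_succ_le n p _).trans ?_
    -- The half grows exactly at odd `k`. Keeping this indicator matters: the cruder bound by the
    -- mean `n * p` may far exceed the mean of `k / 2` when features are small.
    have h1 : ∫ k, ((((k + 1) / 2 : ℕ) : ℝ) - ((k / 2 : ℕ) : ℝ)) ^ 2 ∂(binomial n p) =
        ∫ k, ((k % 2 : ℕ) : ℝ) ∂(binomial n p) := by
      congr 1
      ext k
      rcases Nat.mod_two_eq_zero_or_one k with hk | hk
      · rw [hk, show (k + 1) / 2 = k / 2 by omega]; simp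
      · rw [hk, show (k + 1) / 2 = k / 2 + 1 by omega]; simp
    have h0 : 0 ≤ ∫ k, ((k % 2 : ℕ) : ℝ) ∂(binomial n p) :=
      integral_nonneg fun k => Nat.cast_nonneg _
    -- By size-biasing, the left side is the mean of `k` restricted to even `k`, where `k = 2 * (k /
    -- 2)`.
    have h2 : ((n : ℝ) + 1) * p * ∫ k, ((k % 2 : ℕ) : ℝ) ∂(binomial n p) ≤
        2 * ∫ k, ((k / 2 : ℕ) : ℝ) ∂(binomial (n + 1) p) := by
      have := integral_binomial_mul n p fun k => (((k + 1) % 2 : ℕ) : ℝ)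
      simp only [show ∀ k, (k + 1 + 1) % 2 = k % 2 by intro k; omega] at this
      rw [← this, ← integral_const_mul]
      refine integral_mono (integrable_binomial _) (integrable_binomial _) fun k => ?_
      have : k * ((k + 1) % 2) ≤ 2 * (k / 2) := by
        rcases Nat.mod_two_eq_zero_or_one k with hk | hk
        · rw [show (k + 1) % 2 = 1 by omega]; omega
        · rw [show (k + 1) % 2 = 0 by omega]; omega
      simp only
      exact_mod_cast this
    rw [h1]
    have : (0 : ℝ) ≤ (n + 1) * p * p * ∫ k, ((k % 2 : ℕ) : ℝ) ∂(binomial n p) := by positivity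
    nlinarith

/-- The indicator of the odd numbers that are at least three. -/
def oddTriple (k : ℕ) : ℕ := if k % 2 = 1 ∧ 3 ≤ k then 1 else 0

theorem oddTriple_le_one (k : ℕ) : oddTriple k ≤ 1 := by
  unfold oddTriple; split_ifs <;> simp

theorem oddTriple_le_half (k : ℕ) : oddTriple k ≤ k / 2 := by
  unfold oddTriple; split_ifs <;> omega

/-- An odd set of at least three points merges one pair of its matching with the unmatched point, so
everything still fits. -/
theorem two_mul_half_sub_add_le (k : ℕ) : 2 * (k / 2 - oddTriple k) + 3 * oddTriple k ≤ k := by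
  unfold oddTriple; split_ifs <;> omega

theorem integral_binomial_eq_one (n : ℕ) (p : unitInterval) :
    ∫ k, (if k = 1 then 1 else 0 : ℝ) ∂(binomial n p) = n * p * (1 - p) ^ (n - 1) := by
  rw [integral_binomial]
  cases n with
  | zero => simp
  | succ n => simp

theorem integral_binomial_oddTriple (n : ℕ) (p : unitInterval) :
    ∫ k, (oddTriple k : ℝ) ∂(binomial n p) =
      (1 - (1 - 2 * p) ^ n) / 2 - n * p * (1 - p) ^ (n - 1) := by
  rw [← integral_binomial_eq_one, ← integral_binomial_mod_two,
    ← integral_sub (integrable_binomial _) (integrable_binomial _)]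
  congr 1
  ext k
  unfold oddTriple
  by_cases h1 : k = 1
  · simp [h1]
  · rcases Nat.mod_two_eq_zero_or_one k with hk | hk
    · simp [hk, h1]
    · have : 3 ≤ k := by omega
      simp [hk, h1, this]

theorem variance_binomial_oddTriple_le (n : ℕ) (p : unitInterval) :
    Var[fun k => (oddTriple k : ℝ); binomial n p] ≤ ∫ k, (oddTriple k : ℝ) ∂(binomial n p) := by
  refine (variance_le_expectation_sq (by fun_prop)).trans (le_of_eq ?_)
  congr 1
  ext k
  simp only [Pi.pow_apply]
  unfold oddTriple
  split_ifs <;> simp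

theorem two_mul_integral_binomial_half (n : ℕ) (p : unitInterval) :
    2 * ∫ k, ((k / 2 : ℕ) : ℝ) ∂(binomial n p) = n * p - (1 - (1 - 2 * p) ^ n) / 2 := by
  rw [← integral_binomial_mod_two, ← integral_binomial_id,
    ← integral_sub (integrable_binomial _) (integrable_binomial _), ← integral_const_mul]
  congr 1
  ext k
  have : (k : ℝ) = ((2 * (k / 2) + k % 2 : ℕ) : ℝ) := by rw [Nat.div_add_mod]
  rw [this]
  push_cast
  ring

/-- Parallelogram law: Var(A - B) + Var(A + B) = 2 Var A + 2 Var B, so no covariance has to be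
estimated. -/
theorem variance_binomial_half_sub_le (n : ℕ) (p : unitInterval) :
    Var[fun k => ((k / 2 - oddTriple k : ℕ) : ℝ); binomial n p] ≤
      4 * ∫ k, ((k / 2 : ℕ) : ℝ) ∂(binomial n p) +
        2 * ∫ k, (oddTriple k : ℝ) ∂(binomial n p) := by
  have h1 := variance_binomial_half_le n p
  have h2 := variance_binomial_oddTriple_le n p
  have hA := memLp_binomial (n := n) (p := p) fun k => ((k / 2 : ℕ) : ℝ)
  have hB := memLp_binomial (n := n) (p := p) fun k => (oddTriple k : ℝ)
  have h3 := variance_fun_sub hA hB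
  have h4 := variance_fun_add hA hB
  have h5 := variance_nonneg (fun k => ((k / 2 : ℕ) : ℝ) + (oddTriple k : ℝ)) (binomial n p)
  have h6 : (fun k => ((k / 2 - oddTriple k : ℕ) : ℝ)) =
      fun k => ((k / 2 : ℕ) : ℝ) - (oddTriple k : ℝ) := by
    ext k; rw [Nat.cast_sub (oddTriple_le_half k)]
  rw [h6]
  linarith

end Binomial

/-- The size of a random subset is binomially distributed. -/
theorem map_ncard_setBernoulli {α : Type*} [Finite α] (u : Set α) (p : unitInterval) :
    (setBernoulli u p).map Set.ncard = binomial u.ncard p := by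
  refine Measure.ext_of_singleton fun k => ?_
  rw [map_ncard_setBernoulli_singleton u.toFinite, binomial_singleton]

/-! ### Concentration -/

section Chebyshev

variable {Ω : Type*} [MeasurableSpace Ω] [Finite Ω] [DiscreteMeasurableSpace Ω]

theorem memLp_of_finite (μ : Measure Ω) [IsProbabilityMeasure μ] (X : Ω → ℝ) :
    MemLp X 2 μ :=
  (memLp_two_iff_integrable_sq Measurable.of_discrete.aestronglyMeasurable).2 (.of_finite)

theorem measureReal_abs_sub_ge_le (μ : Measure Ω) [IsProbabilityMeasure μ] (X : Ω → ℝ) {s K : ℝ}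
    (hs : 0 < s) (hK : Var[X; μ] ≤ K) :
    μ.real {ω | s ≤ |X ω - ∫ ω, X ω ∂μ|} ≤ K / s ^ 2 := by
  have h := meas_ge_le_variance_div_sq (memLp_of_finite μ X) hs
  calc μ.real {ω | s ≤ |X ω - ∫ ω, X ω ∂μ|} ≤ Var[X; μ] / s ^ 2 :=
        ENNReal.toReal_le_of_le_ofReal (div_nonneg (variance_nonneg _ _) (sq_nonneg _)) h
    _ ≤ K / s ^ 2 := by gcongr

theorem measureReal_lt_sub_le (μ : Measure Ω) [IsProbabilityMeasure μ] (X : Ω → ℝ) {a s K : ℝ}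
    (hs : 0 < s) (ha : a ≤ ∫ ω, X ω ∂μ) (hK : Var[X; μ] ≤ K) :
    μ.real {ω | X ω < a - s} ≤ K / s ^ 2 := by
  refine le_trans (measureReal_mono fun ω hω => ?_) (measureReal_abs_sub_ge_le μ X hs hK)
  have hω' : X ω < a - s := hω
  have := neg_le_abs (X ω - ∫ ω, X ω ∂μ)
  simp only [Set.mem_ofPred_eq]
  linarith

theorem measureReal_add_lt_le (μ : Measure Ω) [IsProbabilityMeasure μ] (X : Ω → ℝ) {a s K : ℝ}
    (hs : 0 < s) (ha : ∫ ω, X ω ∂μ ≤ a) (hK : Var[X; μ] ≤ K) :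
    μ.real {ω | a + s < X ω} ≤ K / s ^ 2 := by
  refine le_trans (measureReal_mono fun ω hω => ?_) (measureReal_abs_sub_ge_le μ X hs hK)
  have hω' : a + s < X ω := hω
  have := le_abs_self (X ω - ∫ ω, X ω ∂μ)
  simp only [Set.mem_ofPred_eq]
  linarith

end Chebyshev

/-! ### Distinct values among uniform samples -/

/-- Inclusion–exclusion cut off at second order; the quadratic term becomes the collision loss
l²/(2c). -/
theorem one_sub_pow_le {x : ℝ} (hx0 : 0 ≤ x) (hx1 : x ≤ 1) (l : ℕ) :
    (1 - x) ^ l ≤ 1 - l * x + l ^ 2 * x ^ 2 / 2 := by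
  induction l with
  | zero => simp
  | succ l ih =>
    have h1 := mul_le_mul_of_nonneg_right ih (sub_nonneg.2 hx1)
    have h2 : 0 ≤ (l : ℝ) ^ 2 * x ^ 3 := by positivity
    rw [pow_succ]
    push_cast
    nlinarith

section Coupons

variable {α ι : Type*} [Fintype α] [DecidableEq α] [MeasurableSpace α] [DiscreteMeasurableSpace α]
  [Fintype ι]

/-- The probability that independent uniform samples from `A` avoid a given set of values. -/
theorem pi_uniformOn_avoid (A : Finset α) (hA : A.Nonempty) (J : Finset ι) {T : Finset α}
    (hT : T ⊆ A) :
    (Measure.pi fun _ : ι => uniformOn (A : Set α)).real {x | ∀ j ∈ J, x j ∉ T} =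
      (1 - T.card / A.card) ^ J.card := by
  classical
  have : IsProbabilityMeasure (uniformOn (A : Set α)) :=
    isProbabilityMeasure_uniformOn A.finite_toSet (by simpa)
  have h1 : {x : ι → α | ∀ j ∈ J, x j ∉ T} =
      Set.univ.pi fun j => if j ∈ J then ((T : Set α)ᶜ) else Set.univ := by
    ext x
    simp only [Set.mem_ofPred_eq, Set.mem_pi, Set.mem_univ, true_imp_iff]
    refine forall_congr' fun j => ?_
    by_cases hj : j ∈ J <;> simp [hj]
  have hA' : (A.card : ℝ) ≠ 0 := by exact_mod_cast hA.card_pos.ne'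
  have h2 : (uniformOn (A : Set α)).real ((T : Set α)ᶜ) = 1 - T.card / A.card := by
    rw [probReal_compl_eq_one_sub .of_discrete, measureReal_def, uniformOn_apply_finset,
      Finset.inter_eq_right.2 hT]
    simp
  rw [h1, measureReal_def, Measure.pi_pi, ENNReal.toReal_prod, ← h2]
  have h3 (j : ι) : ((uniformOn (A : Set α)) (if j ∈ J then ((T : Set α)ᶜ) else Set.univ)).toReal =
      if j ∈ J then (uniformOn (A : Set α)).real ((T : Set α)ᶜ) else 1 := by
    split_ifs <;> simp [measureReal_def]
  simp_rw [h3]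
  rw [Finset.prod_ite_mem, Finset.univ_inter, Finset.prod_const]

/-- The number of distinct values among `l` independent uniform samples from a set of size `c` is
at least `l - l² / (2 c) - s`, except with probability at most `l / s²`. -/
theorem pi_uniformOn_card_image_lt_le (A : Finset α) (hA : A.Nonempty) (J : Finset ι) {s : ℝ}
    (hs : 0 < s) :
    (Measure.pi fun _ : ι => uniformOn (A : Set α)).real
      {x | ((J.image x).card : ℝ) < J.card - J.card ^ 2 / (2 * A.card) - s} ≤ J.card / s ^ 2 := by
  classical
  have : IsProbabilityMeasure (uniformOn (A : Set α)) :=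
    isProbabilityMeasure_uniformOn A.finite_toSet (by simpa)
  set μ := Measure.pi fun _ : ι => uniformOn (A : Set α) with hμ
  set c : ℝ := (A.card : ℝ) with hc
  have hc0 : 0 < c := by rw [hc]; exact_mod_cast hA.card_pos
  have hc1 : 1 ≤ c := by rw [hc]; exact_mod_cast hA.card_pos
  set l : ℝ := (J.card : ℝ) with hl
  let B : α → Set (ι → α) := fun e => {x | ∀ j ∈ J, x j ∉ ({e} : Finset α)}
  -- The number of values that are missed; the distinct values are counted as `c - N`.
  let N : (ι → α) → ℝ := fun x => ∑ e ∈ A, (B e).indicator 1 x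
  set r : ℝ := (1 - 1 / c) ^ J.card with hr
  have hB (e : α) (he : e ∈ A) : μ.real (B e) = r := by
    rw [hr, pi_uniformOn_avoid A hA J (T := {e}) (by simpa)]
    simp [c]
  have hBB (e f : α) (he : e ∈ A) (hf : f ∈ A) (hef : e ≠ f) :
      μ.real (B e ∩ B f) = (1 - 2 / c) ^ J.card := by
    have := pi_uniformOn_avoid A hA J (T := {e, f}) (by
      intro x hx; simp at hx; rcases hx with rfl | rfl <;> assumption)
    rw [Finset.card_pair hef] at this
    rw [← hμ] at this
    push_cast at this
    rw [← this]
    congr 1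
    ext x
    simp only [B, Set.mem_inter_iff, Set.mem_ofPred_eq, Finset.mem_singleton, Finset.mem_insert,
      not_or, ← forall_and]
  have hEN : ∫ x, N x ∂μ = c * r := by
    simp only [N]
    rw [integral_finsetSum _ fun _ _ => .of_finite]
    simp_rw [integral_indicator_one (MeasurableSet.of_discrete)]
    rw [Finset.sum_congr rfl hB]
    simp [c]
  have hr0 : 0 ≤ r := pow_nonneg (by rw [sub_nonneg, div_le_one hc0]; exact hc1) _
  have hr1 : 1 - l / c ≤ r := by
    have := one_add_mul_le_pow (a := -(1 / c)) (by
      have : 1 / c ≤ 1 := by rw [div_le_one hc0]; exact hc1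
      linarith) J.card
    rw [hr, sub_eq_add_neg 1 (1 / c)]
    refine le_trans (le_of_eq ?_) this
    ring
  have hr2 : r ≤ 1 - l / c + l ^ 2 / (2 * c ^ 2) := by
    have := one_sub_pow_le (x := 1 / c) (by positivity) (by rw [div_le_one hc0]; exact hc1) J.card
    refine this.trans (le_of_eq ?_)
    rw [← hl]
    field_simp
  -- The events of missing two different values are negatively correlated, since 1 - 2/c ≤ (1 -
  -- 1/c)². Hence Var N ≤ c r (1 - r) ≤ c (1 - r) ≤ l.
  have hEN2 : ∫ x, N x ^ 2 ∂μ ≤ c * r + (c * r) ^ 2 - c * r ^ 2 := by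
    have h1 (x : ι → α) : N x ^ 2 = ∑ e ∈ A, ∑ f ∈ A, (B e ∩ B f).indicator 1 x := by
      simp only [N, sq, Finset.sum_mul_sum, Set.inter_indicator_one, Pi.mul_apply]
    simp_rw [h1]
    rw [integral_finsetSum _ fun _ _ => .of_finite]
    simp_rw [integral_finsetSum A fun _ _ => Integrable.of_finite,
      integral_indicator_one (MeasurableSet.of_discrete)]
    have h2 (e : α) (he : e ∈ A) : ∑ f ∈ A, μ.real (B e ∩ B f) ≤ r + (c - 1) * r ^ 2 := by
      rw [← Finset.add_sum_erase A _ he, Set.inter_self, hB e he]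
      gcongr
      -- For `c = 1` the base `1 - 2 / c` is negative and powers are not monotone, but then there is
      -- no second value.
      by_cases hA1 : c = 1
      · have : A.erase e = ∅ := by
          rw [← Finset.card_eq_zero, Finset.card_erase_of_mem he]
          have : A.card = 1 := by rw [hc] at hA1; exact_mod_cast hA1
          omega
        rw [this, hA1]; simp
      · have hc2 : 2 ≤ c := by
          have : A.card ≠ 1 := fun h => hA1 (by rw [hc, h]; simp)
          have : 2 ≤ A.card := by have := hA.card_pos; omega
          rw [hc]; exact_mod_cast this
        have h3 : ∀ f ∈ A.erase e, μ.real (B e ∩ B f) ≤ r ^ 2 := by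
          intro f hf
          rw [Finset.mem_erase] at hf
          rw [hBB e f he hf.2 hf.1.symm, hr, ← pow_mul, mul_comm, pow_mul]
          refine pow_le_pow_left₀ (by rw [sub_nonneg, div_le_one hc0]; exact hc2) ?_ _
          have : 0 ≤ (1 / c) ^ 2 := by positivity
          have h2c : 2 / c = 2 * (1 / c) := by ring
          rw [h2c]
          nlinarith
        refine (Finset.sum_le_card_nsmul _ _ _ h3).trans (le_of_eq ?_)
        rw [Finset.card_erase_of_mem he, nsmul_eq_mul, Nat.cast_sub hA.card_pos]
        simp [c]
    refine (Finset.sum_le_card_nsmul _ _ _ h2).trans (le_of_eq ?_)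
    rw [nsmul_eq_mul, ← hc]
    ring
  have hr3 : r ≤ 1 := pow_le_one₀ (by rw [sub_nonneg, div_le_one hc0]; exact hc1)
    (by have : 0 < 1 / c := by positivity
        linarith)
  have hVar : Var[fun x => c - N x; μ] ≤ l := by
    rw [variance_const_sub (Measurable.of_discrete.aestronglyMeasurable),
      variance_eq_sub (memLp_of_finite μ N)]
    have h1 : μ[N ^ 2] = ∫ x, N x ^ 2 ∂μ := rfl
    rw [h1, hEN]
    have h2 : c * (1 - r) ≤ l := by
      have := mul_le_mul_of_nonneg_left hr1 hc0.le
      rw [mul_sub, mul_div_cancel₀ _ hc0.ne'] at this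
      linarith
    have h3 : 0 ≤ c * (1 - r) * (1 - r) := by
      have := sub_nonneg.2 hr3
      positivity
    nlinarith
  have hE : l - l ^ 2 / (2 * c) ≤ ∫ x, (c - N x) ∂μ := by
    rw [integral_sub (integrable_const _) .of_finite, hEN]
    have h1 := mul_le_mul_of_nonneg_left hr2 hc0.le
    have h2 : c * (1 - l / c + l ^ 2 / (2 * c ^ 2)) = c - l + l ^ 2 / (2 * c) := by
      field_simp
    simp
    linarith
  refine le_trans (measureReal_mono fun x hx => ?_) (measureReal_lt_sub_le μ _ hs hE hVar)
  simp only [Set.mem_ofPred_eq] at hx ⊢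
  refine lt_of_le_of_lt ?_ hx
  have h1 : N x = ((A.filter fun e => e ∉ J.image x).card : ℝ) := by
    simp only [N, Finset.card_filter, Nat.cast_sum]
    refine Finset.sum_congr rfl fun e _ => ?_
    by_cases he : x ∈ B e
    · have : e ∉ J.image x := by
        simp only [Finset.mem_image, not_exists, not_and]
        intro j hj hje
        exact he j hj (by simp [hje])
      simp [he, this]
    · have : e ∈ J.image x := by
        simp only [B, Set.mem_ofPred_eq, not_forall, not_not, Finset.mem_singleton] at he
        obtain ⟨j, hj, hje⟩ := he
        exact Finset.mem_image.2 ⟨j, hj, hje⟩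
      simp [he, this]
  have h2 : A.card ≤ (J.image x).card + (A.filter fun e => e ∉ J.image x).card := by
    rw [← Finset.card_filter_add_card_filter_not (s := A) (fun e => e ∈ J.image x)]
    gcongr
    intro e he
    exact (Finset.mem_filter.1 he).2
  rw [h1, hc]
  have : (A.card : ℝ) ≤ (J.image x).card + (A.filter fun e => e ∉ J.image x).card := by
    exact_mod_cast h2
  linarith

end Coupons

/-! ### Moving sets by permutations -/

/-- A bijection onto `s` from a subset of `t` of the same size extends to a permutation. -/
theorem exists_perm_subset_image {α : Type*} [Finite α] {s t : Set α} (h : s.ncard ≤ t.ncard) :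
    ∃ g : Equiv.Perm α, s ⊆ g '' t := by
  classical
  have := Fintype.ofFinite α
  obtain ⟨r, hrt, hr⟩ := Set.exists_subset_card_eq h
  have hc : Fintype.card {x // x ∈ r} = Fintype.card {x // x ∈ s} := by
    rw [← Nat.card_eq_fintype_card, ← Nat.card_eq_fintype_card]
    exact hr
  refine ⟨(Fintype.equivOfCardEq hc).extendSubtype, fun x hx => ?_⟩
  refine ⟨((Fintype.equivOfCardEq hc).symm ⟨x, hx⟩ : α), hrt (Subtype.property _), ?_⟩
  rw [Equiv.extendSubtype_apply_of_mem _ _ (Subtype.property _)]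
  simp

/-- Inside a given set `u`, any subset can be moved over any subset that is not larger. -/
theorem exists_perm_subset_image_of_subset {α : Type*} [Finite α] {u s t : Set α} (hs : s ⊆ u)
    (ht : t ⊆ u) (h : s.ncard ≤ t.ncard) :
    ∃ g : Equiv.Perm α, (∀ a, g a ∈ u ↔ a ∈ u) ∧ (∀ a, a ∉ u → g a = a) ∧ s ⊆ g '' t := by
  classical
  have hcard (r : Set α) (hr : r ⊆ u) : (((↑) : u → α) ⁻¹' r).ncard = r.ncard := by
    rw [Set.ncard_preimage_of_injective_subset_range Subtype.val_injective (by simpa)]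
  obtain ⟨g, hg⟩ := exists_perm_subset_image (α := u) (s := (↑) ⁻¹' s) (t := (↑) ⁻¹' t)
    (by rwa [hcard s hs, hcard t ht])
  refine ⟨Equiv.Perm.ofSubtype g, fun a => ?_, fun a ha => Equiv.Perm.ofSubtype_apply_of_not_mem g ha,
    fun x hx => ?_⟩
  · by_cases ha : a ∈ u
    · rw [Equiv.Perm.ofSubtype_apply_of_mem g ha]
      simp [ha]
    · rw [Equiv.Perm.ofSubtype_apply_of_not_mem g ha]
  · obtain ⟨y, hy, hyx⟩ := hg (show (⟨x, hs hx⟩ : u) ∈ (↑) ⁻¹' s from hx)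
    refine ⟨y, hy, ?_⟩
    rw [Equiv.Perm.ofSubtype_apply_coe, hyx]

/-! ### Invariance under permutations -/

/-- The mass of a subset `s` of `u` depends only on the sizes of `s` and `u \ s`. -/
theorem map_image_setBernoulli {α : Type*} [Finite α] (u : Set α) (p : unitInterval)
    (g : Equiv.Perm α) (hg : ∀ a, g a ∈ u ↔ a ∈ u) :
    (setBernoulli u p).map (fun s => g '' s) = setBernoulli u p := by
  refine Measure.ext_of_singleton fun s => ?_
  have hpre : (fun s => g '' s) ⁻¹' ({s} : Set (Set α)) = {g ⁻¹' s} := by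
    ext t
    simp only [Set.mem_preimage, Set.mem_singleton_iff]
    constructor
    · rintro rfl; simp
    · rintro rfl; simp
  rw [Measure.map_apply .of_discrete .of_discrete, hpre]
  have hu : g ⁻¹' u = u := by ext; simp [hg]
  have hn (r : Set α) : (g ⁻¹' r).ncard = r.ncard := Set.ncard_preimage_of_injective_subset_range
    g.injective (by simp)
  have hsub : g ⁻¹' s ⊆ u ↔ s ⊆ u := by
    conv_lhs => rw [← hu]
    exact Set.preimage_subset_preimage_iff (by simp)
  by_cases hs : s ⊆ u
  · rw [setBernoulli_singleton p (hsub.2 hs) u.toFinite, setBernoulli_singleton p hs u.toFinite, hn]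
    conv_lhs => rw [← hu, ← Set.preimage_sdiff, hn]
  · rw [setBernoulli_singleton_of_not_subset p hs,
      setBernoulli_singleton_of_not_subset p (mt hsub.1 hs)]

theorem map_uniformOn_perm {α : Type*} [Finite α] [MeasurableSpace α] [DiscreteMeasurableSpace α]
    (A : Finset α) (g : Equiv.Perm α) (hg : ∀ a, g a ∈ A ↔ a ∈ A) :
    (uniformOn (A : Set α)).map g = uniformOn (A : Set α) := by
  classical
  refine Measure.ext_of_singleton fun a => ?_
  have hpre : g ⁻¹' {a} = (({g.symm a} : Finset α) : Set α) := by
    ext b; simp [Equiv.eq_symm_apply]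
  have h1 : g.symm a ∈ A ↔ a ∈ A := by rw [← hg, Equiv.apply_symm_apply]
  rw [Measure.map_apply .of_discrete .of_discrete, hpre, ← Finset.coe_singleton,
    uniformOn_apply_finset, uniformOn_apply_finset]
  by_cases ha : a ∈ A
  · rw [Finset.inter_singleton_of_mem ha, Finset.inter_singleton_of_mem (h1.2 ha)]; simp
  · rw [Finset.inter_singleton_of_notMem ha, Finset.inter_singleton_of_notMem (mt h1.1 ha)]

theorem map_pi_of_map_eq {ι : Type*} [Fintype ι] {α : ι → Type*} [∀ i, MeasurableSpace (α i)]
    [∀ i, DiscreteMeasurableSpace (α i)] (μ : ∀ i, Measure (α i)) [∀ i, IsProbabilityMeasure (μ i)]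
    (g : ∀ i, α i → α i) (h : ∀ i, (μ i).map (g i) = μ i) :
    (Measure.pi μ).map (fun x i => g i (x i)) = Measure.pi μ :=
  (measurePreserving_pi μ μ fun i => ⟨.of_discrete, h i⟩).map_eq

/-! ### Independent uniform pairs and triples -/

/-- The `i`-element subsets of the vertex set. -/
def subsetsOfCard (i n : ℕ) : Finset (Finset (Fin n)) := Finset.powersetCard i Finset.univ

theorem mem_subsetsOfCard {i n : ℕ} {e : Finset (Fin n)} : e ∈ subsetsOfCard i n ↔ e.card = i := by
  simp [subsetsOfCard]

theorem card_subsetsOfCard (i n : ℕ) : (subsetsOfCard i n).card = n.choose i := by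
  simp [subsetsOfCard]

theorem subsetsOfCard_nonempty {i n : ℕ} (h : i ≤ n) : (subsetsOfCard i n).Nonempty := by
  rw [← Finset.card_pos, card_subsetsOfCard]
  exact Nat.choose_pos h

/-- The law of a family of independent uniform `i`-element subsets. -/
noncomputable def familyLaw (i n : ℕ) (ι : Type*) [Fintype ι] : Measure (ι → Finset (Fin n)) :=
  Measure.pi fun _ => uniformOn (subsetsOfCard i n : Set (Finset (Fin n)))

theorem isProbabilityMeasure_uniformOn_subsetsOfCard {i n : ℕ} (h : i ≤ n) :
    IsProbabilityMeasure (uniformOn (subsetsOfCard i n : Set (Finset (Fin n)))) :=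
  isProbabilityMeasure_uniformOn (Finset.finite_toSet _) (by simpa using subsetsOfCard_nonempty h)

theorem isProbabilityMeasure_familyLaw {i n : ℕ} (h : i ≤ n) (ι : Type*) [Fintype ι] :
    IsProbabilityMeasure (familyLaw i n ι) := by
  have := isProbabilityMeasure_uniformOn_subsetsOfCard h
  unfold familyLaw
  infer_instance

theorem map_familyLaw {i n : ℕ} (h : i ≤ n) {ι : Type*} [Fintype ι]
    (g : ι → Equiv.Perm (Finset (Fin n))) (hg : ∀ j e, (g j e).card = e.card) :
    (familyLaw i n ι).map (fun x j => g j (x j)) = familyLaw i n ι := by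
  have := isProbabilityMeasure_uniformOn_subsetsOfCard h
  exact map_pi_of_map_eq _ (fun j => g j) fun j =>
    map_uniformOn_perm _ _ fun e => by rw [mem_subsetsOfCard, mem_subsetsOfCard, hg]

theorem ae_familyLaw_card {i n : ℕ} (h : i ≤ n) (ι : Type*) [Fintype ι] :
    ∀ᵐ x ∂(familyLaw i n ι), ∀ j, (x j).card = i := by
  have := isProbabilityMeasure_uniformOn_subsetsOfCard h
  rw [eventually_countable_forall]
  intro j
  have h1 : ∀ᵐ e ∂(uniformOn (subsetsOfCard i n : Set (Finset (Fin n)))), e.card = i := by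
    have := uniformOn_self (s := (subsetsOfCard i n : Set (Finset (Fin n)))) (Finset.finite_toSet _)
      (by simpa using subsetsOfCard_nonempty h)
    rw [← prob_compl_eq_zero_iff .of_discrete] at this
    refine measure_mono_null (fun e he => ?_) this
    simpa [mem_subsetsOfCard] using he
  exact (measurePreserving_eval (fun _ : ι => uniformOn (subsetsOfCard i n : Set (Finset (Fin n))))
    j).quasiMeasurePreserving.ae h1

theorem hypergraphLaw_ae_card (i n : ℕ) (q : ℝ) :
    ∀ᵐ E ∂(hypergraphLaw i n q), E ⊆ {e | e.card = i} :=
  setBernoulli_ae_subset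

instance isProbabilityMeasure_hypergraphLaw (i n : ℕ) (q : ℝ) :
    IsProbabilityMeasure (hypergraphLaw i n q) := by
  unfold hypergraphLaw; infer_instance

/-- The permutations of the subsets of the vertex set that preserve the cardinality. -/
def cardPerm (n : ℕ) : Subgroup (Equiv.Perm (Finset (Fin n))) where
  carrier := {g | ∀ e, (g e).card = e.card}
  mul_mem' := fun {g h} hg hh e => by
    simp only [Set.mem_ofPred_eq] at hg hh
    rw [Equiv.Perm.mul_apply, hg, hh]
  one_mem' := fun e => by simp
  inv_mem' := fun {g} hg e => by
    simp only [Set.mem_ofPred_eq] at hg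
    rw [← hg (g⁻¹ e)]; simp

theorem map_hypergraphLaw (i n : ℕ) (q : ℝ) (g : cardPerm n) :
    (hypergraphLaw i n q).map (fun E => g.1 '' E) = hypergraphLaw i n q :=
  map_image_setBernoulli _ _ _ fun e => by
    have := g.2 e
    simp only [Set.mem_ofPred_eq]
    rw [this]

/-- The permutations for the two cardinalities have disjoint supports, so their product does both
jobs. -/
theorem exists_cardPerm {n : ℕ} {i j : ℕ} (hij : i ≠ j) {s t s' t' : Set (Finset (Fin n))}
    (hs : s ⊆ {e | e.card = i}) (ht : t ⊆ {e | e.card = i}) (h : s.ncard ≤ t.ncard)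
    (hs' : s' ⊆ {e | e.card = j}) (ht' : t' ⊆ {e | e.card = j}) (h' : s'.ncard ≤ t'.ncard) :
    ∃ g : cardPerm n, s ⊆ g.1 '' t ∧ s' ⊆ g.1 '' t' := by
  obtain ⟨g, hg, hg1, hgs⟩ := exists_perm_subset_image_of_subset hs ht h
  obtain ⟨g', hg', hg1', hgs'⟩ := exists_perm_subset_image_of_subset hs' ht' h'
  simp only [Set.mem_ofPred_eq] at hg hg1 hg' hg1'
  have hc (e) : (g e).card = e.card := by
    by_cases he : e.card = i
    · rw [(hg e).2 he, he]
    · rw [hg1 e he]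
  have hc' (e) : (g' e).card = e.card := by
    by_cases he : e.card = j
    · rw [(hg' e).2 he, he]
    · rw [hg1' e he]
  refine ⟨⟨g * g', fun e => by rw [Equiv.Perm.mul_apply, hc, hc']⟩, fun e he => ?_, fun e he => ?_⟩
  · obtain ⟨d, hd, rfl⟩ := hgs he
    refine ⟨d, hd, ?_⟩
    have : d.card = i := ht hd
    simp [hg1' d (by omega)]
  · obtain ⟨d, hd, rfl⟩ := hgs' he
    refine ⟨d, hd, ?_⟩
    have : d.card = j := ht' hd
    simp only [Equiv.Perm.mul_apply]
    rw [hg1 _ (by rw [hc', this]; exact hij.symm)]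

/-! ### The coupling for a fixed number of vertices -/

section FixedN

variable {n m : ℕ}

/-- The law of the family of the vertex sets of the features. -/
noncomputable def featureLaw (n m : ℕ) (p : Fin m → ℝ) : Measure (Fin m → Set (Fin n)) :=
  Measure.pi fun i : Fin m => setBernoulli (Set.univ : Set (Fin n)) (prob (p i))

instance isProbabilityMeasure_featureLaw (p : Fin m → ℝ) :
    IsProbabilityMeasure (featureLaw n m p) := by
  unfold featureLaw; infer_instance

/-- A table of pairs and a list of triples, indexed by the features. -/
abbrev Samples (n m : ℕ) : Type :=
  (Fin m × Fin n → Finset (Fin n)) × (Fin m → Finset (Fin n))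

/-- The law of independent uniform pairs and triples. -/
noncomputable def samplesLaw (n m : ℕ) : Measure (Samples n m) :=
  (familyLaw 2 n (Fin m × Fin n)).prod (familyLaw 3 n (Fin m))

theorem isProbabilityMeasure_samplesLaw (hn : 3 ≤ n) (m : ℕ) :
    IsProbabilityMeasure (samplesLaw n m) := by
  have := isProbabilityMeasure_familyLaw (show 2 ≤ n by omega) (Fin m × Fin n)
  have := isProbabilityMeasure_familyLaw hn (Fin m)
  unfold samplesLaw
  infer_instance

/-- The positions of the pairs that are used, if a feature with `k` vertices uses `f k` pairs. -/
noncomputable def pairIndices (f : ℕ → ℕ) (V : Fin m → Set (Fin n)) : Finset (Fin m × Fin n) :=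
  Finset.univ.filter fun j => j.2.val < f (V j.1).ncard

/-- The positions of the triples that are used, if a feature with `k` vertices uses a triple
when `0 < z k`. -/
noncomputable def tripleIndices (z : ℕ → ℕ) (V : Fin m → Set (Fin n)) : Finset (Fin m) :=
  Finset.univ.filter fun i => 0 < z (V i).ncard

theorem card_pairIndices (f : ℕ → ℕ) (hf : ∀ k, f k ≤ k) (V : Fin m → Set (Fin n)) :
    (pairIndices f V).card = ∑ i, f (V i).ncard := by
  classical
  have h1 (i : Fin m) : (Finset.univ.filter fun j : Fin n => j.val < f (V i).ncard).card =
      f (V i).ncard := by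
    -- Each feature owns `n` slots in the table of pairs, which is always enough.
    have h2 : f (V i).ncard ≤ n := (hf _).trans ((Set.ncard_le_card _).trans (by simp))
    rw [Fin.card_filter_val_lt]
    omega
  rw [← Finset.sum_congr rfl fun i _ => h1 i, ← Finset.card_sigma]
  refine Finset.card_bij (fun j _ => ⟨j.1, j.2⟩) ?_ ?_ ?_
  · intro j hj
    simpa [pairIndices] using hj
  · intro j _ j' _ h
    simp only [Sigma.mk.injEq, heq_eq_eq] at h
    exact Prod.ext h.1 h.2
  · rintro ⟨i, j⟩ h
    exact ⟨(i, j), by simpa [pairIndices] using h, rfl⟩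

theorem card_tripleIndices (z : ℕ → ℕ) (hz : ∀ k, z k ≤ 1) (V : Fin m → Set (Fin n)) :
    (tripleIndices z V).card = ∑ i, z (V i).ncard := by
  rw [tripleIndices, Finset.card_filter]
  refine Finset.sum_congr rfl fun i _ => ?_
  have := hz (V i).ncard
  split_ifs <;> omega

/-- The pairs of the samples that are used. -/
noncomputable def usedPairs (f : ℕ → ℕ) (w : Samples n m × (Fin m → Set (Fin n))) :
    Finset (Finset (Fin n)) :=
  (pairIndices f w.2).image w.1.1

/-- The triples of the samples that are used. -/
noncomputable def usedTriples (z : ℕ → ℕ) (w : Samples n m × (Fin m → Set (Fin n))) :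
    Finset (Finset (Fin n)) :=
  (tripleIndices z w.2).image w.1.2

/-- The vertex sets `V` contain all pairs and triples of the samples that are used. -/
def CoversSamples (f z : ℕ → ℕ) (w : Samples n m × (Fin m → Set (Fin n)))
    (V : Fin m → Set (Fin n)) : Prop :=
  ∀ i, (∀ j : Fin n, (i, j) ∈ pairIndices f w.2 → (w.1.1 (i, j) : Set (Fin n)) ⊆ V i) ∧
    (i ∈ tripleIndices z w.2 → (w.1.2 i : Set (Fin n)) ⊆ V i)

/-- The feature sets inside the first component matter only through their sizes, which decide how
many samples are used. The second component is a fresh placement of features with the same law,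
lying over those samples. Orbit coupling applies with one vertex permutation per feature. -/
theorem exists_coupling_coversSamples (hn : 3 ≤ n) (p : Fin m → ℝ) {f z : ℕ → ℕ}
    (hfz : ∀ k, 2 * f k + 3 * z k ≤ k) :
    ∃ π : Measure ((Samples n m × (Fin m → Set (Fin n))) × (Fin m → Set (Fin n))),
      IsProbabilityMeasure π ∧ π.map Prod.fst = (samplesLaw n m).prod (featureLaw n m p) ∧
      π.map Prod.snd = featureLaw n m p ∧ π {t | CoversSamples f z t.1 t.2} = 1 := by
  classical
  have := isProbabilityMeasure_familyLaw (show 2 ≤ n by omega) (Fin m × Fin n)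
  have := isProbabilityMeasure_familyLaw hn (Fin m)
  have := isProbabilityMeasure_samplesLaw hn m
  set μ := samplesLaw n m
  set ν := featureLaw n m p
  -- Starting from two equal copies of the features makes the sizes agree, so a covering permutation
  -- exists almost surely.
  let ρ : Measure ((Samples n m × (Fin m → Set (Fin n))) × (Fin m → Set (Fin n))) :=
    (μ.prod ν).map fun w => (w, w.2)
  have hρ : IsProbabilityMeasure ρ :=
    Measure.isProbabilityMeasure_map Measurable.of_discrete.aemeasurable
  have hfst : ρ.map Prod.fst = μ.prod ν := by
    rw [Measure.map_map .of_discrete .of_discrete]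
    exact Measure.map_id
  have hsnd : ρ.map Prod.snd = ν := by
    rw [Measure.map_map .of_discrete .of_discrete]
    have : (Prod.snd ∘ fun w : Samples n m × (Fin m → Set (Fin n)) => (w, w.2)) = Prod.snd := rfl
    rw [this]
    exact Measure.snd_prod
  let a : (Fin m → Equiv.Perm (Fin n)) → Samples n m × (Fin m → Set (Fin n)) →
      Samples n m × (Fin m → Set (Fin n)) :=
    fun g w => ((fun j => (g j.1).finsetCongr (w.1.1 j), fun i => (g i).finsetCongr (w.1.2 i)), w.2)
  let b : (Fin m → Equiv.Perm (Fin n)) → (Fin m → Set (Fin n)) → Fin m → Set (Fin n) :=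
    fun g V i => g i '' V i
  obtain ⟨π, hπ, h1, h2, h3⟩ := exists_orbit_coupling ρ a b (by
      intro g h V
      ext i x
      simp [b, Set.image_image]) (by
      intro g
      rw [hfst]
      have hμ : μ.map (fun x : Samples n m => (fun j => (g j.1).finsetCongr (x.1 j),
          fun i => (g i).finsetCongr (x.2 i))) = μ := by
        have e1 := map_familyLaw (show 2 ≤ n by omega) (ι := Fin m × Fin n)
          (fun j => (g j.1).finsetCongr) (by simp)
        have e2 := map_familyLaw hn (ι := Fin m) (fun i => (g i).finsetCongr) (by simp)
        have := Measure.map_prod_map (familyLaw 2 n (Fin m × Fin n)) (familyLaw 3 n (Fin m))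
          (f := fun x j => (g j.1).finsetCongr (x j)) (g := fun x i => (g i).finsetCongr (x i))
          .of_discrete .of_discrete
        rw [e1, e2] at this
        exact this.symm
      have := Measure.map_prod_map μ ν (f := fun x : Samples n m =>
        ((fun j => (g j.1).finsetCongr (x.1 j), fun i => (g i).finsetCongr (x.2 i)) : Samples n m))
        (g := id) .of_discrete .of_discrete
      rw [hμ, Measure.map_id] at this
      exact this.symm) (by
      intro g
      rw [hsnd]
      exact map_pi_of_map_eq _ (fun i V => g i '' V) fun i =>
        map_image_setBernoulli _ _ _ (by simp))
    (CoversSamples f z) (by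
      intro g w V h i
      refine ⟨fun j hj => ?_, fun hi => ?_⟩
      · have := (h i).1 j hj
        simp only [a, b, Equiv.finsetCongr_apply, Finset.coe_map]
        exact Set.image_mono this
      · have := (h i).2 hi
        simp only [a, b, Equiv.finsetCongr_apply, Finset.coe_map]
        exact Set.image_mono this)
  refine ⟨π, hπ, h1.trans hfst, h2.trans hsnd, le_antisymm prob_le_one (le_trans ?_ h3)⟩
  rw [Measure.map_apply .of_discrete .of_discrete]
  refine le_of_eq (Eq.symm ?_)
  rw [← prob_compl_eq_zero_iff .of_discrete]
  have hae : ∀ᵐ w ∂(μ.prod ν), (∀ j, (w.1.1 j).card = 2) ∧ ∀ i, (w.1.2 i).card = 3 := by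
    have q1 : ∀ᵐ x ∂μ, (∀ j, (x.1 j).card = 2) ∧ ∀ i, (x.2 i).card = 3 :=
      (Measure.quasiMeasurePreserving_fst.ae (ae_familyLaw_card (by omega) _)).and
        (Measure.quasiMeasurePreserving_snd.ae (ae_familyLaw_card hn _))
    exact Measure.quasiMeasurePreserving_fst.ae q1
  refine measure_mono_null (fun w hw => ?_) (ae_iff.1 hae)
  simp only [Set.mem_ofPred_eq]
  intro ⟨hw2, hw3⟩
  apply hw
  simp only [Set.mem_preimage, Set.mem_ofPred_eq]
  have hex (i : Fin m) : ∃ g : Equiv.Perm (Fin n),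
      (∀ j : Fin n, (i, j) ∈ pairIndices f w.2 → (w.1.1 (i, j) : Set (Fin n)) ⊆ g '' w.2 i) ∧
        (i ∈ tripleIndices z w.2 → (w.1.2 i : Set (Fin n)) ⊆ g '' w.2 i) := by
    let k := (w.2 i).ncard
    -- All vertices of the samples that feature `i` uses. Overlaps only make this set smaller.
    let T : Finset (Fin n) := ((Finset.univ.filter fun j : Fin n => j.val < f k).biUnion
      fun j => w.1.1 (i, j)) ∪ if 0 < z k then w.1.2 i else ∅
    have hT : T.card ≤ k := by
      refine (Finset.card_union_le _ _).trans (le_trans (add_le_add (b := 2 * f k) (d := 3 * z k)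
        ?_ ?_) (hfz k))
      · refine (Finset.card_biUnion_le_card_mul _ _ 2 fun j _ => (hw2 _).le).trans ?_
        rw [mul_comm, Fin.card_filter_val_lt]
        gcongr
        exact min_le_right _ _
      · split_ifs with hz
        · rw [hw3]; omega
        · simp
    obtain ⟨g, hg⟩ := exists_perm_subset_image (s := (T : Set (Fin n))) (t := w.2 i)
      (by rwa [Set.ncard_coe_finset])
    refine ⟨g, fun j hj => subset_trans ?_ hg, fun hi => subset_trans ?_ hg⟩
    · intro v hv
      simp only [pairIndices, Finset.mem_filter, Finset.mem_univ, true_and] at hj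
      simp only [T, Finset.coe_union, Set.mem_union, Finset.mem_coe, Finset.mem_biUnion]
      exact Or.inl ⟨j, by simpa using hj, hv⟩
    · intro v hv
      simp only [tripleIndices, Finset.mem_filter, Finset.mem_univ, true_and] at hi
      simp only [T, Finset.coe_union, Set.mem_union, Finset.mem_coe]
      exact Or.inr (by rw [if_pos hi]; exact hv)
  choose g hg using hex
  exact ⟨g, hg⟩

/-- Exchangeability reduces inclusion of families to comparison of sizes under the independent
product law. -/
theorem exists_coupling_usedSamples (hn : 3 ≤ n) (p : Fin m → ℝ) (f z : ℕ → ℕ) (q₂ q₃ : ℝ) :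
    ∃ π : Measure ((Set (Finset (Fin n)) × Set (Finset (Fin n))) ×
        (Samples n m × (Fin m → Set (Fin n)))),
      IsProbabilityMeasure π ∧
      π.map Prod.fst = (hypergraphLaw 2 n q₂).prod (hypergraphLaw 3 n q₃) ∧
      π.map Prod.snd = (samplesLaw n m).prod (featureLaw n m p) ∧
      π.real {t | ¬ (t.1.1 ⊆ usedPairs f t.2 ∧ t.1.2 ⊆ usedTriples z t.2)} ≤
        (((hypergraphLaw 2 n q₂).prod (hypergraphLaw 3 n q₃)).prod
          ((samplesLaw n m).prod (featureLaw n m p))).real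
          {t | ¬ (t.1.1.ncard ≤ (usedPairs f t.2).card ∧
            t.1.2.ncard ≤ (usedTriples z t.2).card)} := by
  classical
  have := isProbabilityMeasure_familyLaw (show 2 ≤ n by omega) (Fin m × Fin n)
  have := isProbabilityMeasure_familyLaw hn (Fin m)
  have := isProbabilityMeasure_samplesLaw hn m
  set μ := samplesLaw n m
  set ν := featureLaw n m p
  set ξ := (hypergraphLaw 2 n q₂).prod (hypergraphLaw 3 n q₃)
  -- The group permutes the pairs and triples themselves, not just the vertices; only so can any
  -- family be moved over any other that is at least as large.
  let a : cardPerm n → Set (Finset (Fin n)) × Set (Finset (Fin n)) →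
      Set (Finset (Fin n)) × Set (Finset (Fin n)) := fun g E => (g.1 '' E.1, g.1 '' E.2)
  let b : cardPerm n → Samples n m × (Fin m → Set (Fin n)) →
      Samples n m × (Fin m → Set (Fin n)) :=
    fun g w => ((fun j => g.1 (w.1.1 j), fun i => g.1 (w.1.2 i)), w.2)
  have hup (g : cardPerm n) (w) : (usedPairs f (b g w) : Set (Finset (Fin n))) =
      g.1 '' usedPairs f w := by
    simp only [usedPairs, b, Finset.coe_image, Set.image_image]
  have hut (g : cardPerm n) (w) : (usedTriples z (b g w) : Set (Finset (Fin n))) =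
      g.1 '' usedTriples z w := by
    simp only [usedTriples, b, Finset.coe_image, Set.image_image]
  have hfst : (ξ.prod (μ.prod ν)).map Prod.fst = ξ := Measure.fst_prod
  have hsnd : (ξ.prod (μ.prod ν)).map Prod.snd = μ.prod ν := Measure.snd_prod
  obtain ⟨π, hπ, h1, h2, h3⟩ := exists_orbit_coupling (ξ.prod (μ.prod ν)) a b (by
      intro g h w
      simp [b]) (by
      intro g
      rw [hfst]
      have := Measure.map_prod_map (hypergraphLaw 2 n q₂) (hypergraphLaw 3 n q₃)
        (f := fun E => g.1 '' E) (g := fun E => g.1 '' E) .of_discrete .of_discrete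
      rw [map_hypergraphLaw, map_hypergraphLaw] at this
      exact this.symm) (by
      intro g
      rw [hsnd]
      have hμ : μ.map (fun x : Samples n m => (fun j => g.1 (x.1 j), fun i => g.1 (x.2 i))) = μ := by
        have e1 := map_familyLaw (show 2 ≤ n by omega) (ι := Fin m × Fin n)
          (fun _ => g.1) (fun _ => g.2)
        have e2 := map_familyLaw hn (ι := Fin m) (fun _ => g.1) (fun _ => g.2)
        have := Measure.map_prod_map (familyLaw 2 n (Fin m × Fin n)) (familyLaw 3 n (Fin m))
          (f := fun x j => g.1 (x j)) (g := fun x i => g.1 (x i))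
          .of_discrete .of_discrete
        rw [e1, e2] at this
        exact this.symm
      have := Measure.map_prod_map μ ν (f := fun x : Samples n m =>
        ((fun j => g.1 (x.1 j), fun i => g.1 (x.2 i)) : Samples n m))
        (g := id) .of_discrete .of_discrete
      rw [hμ, Measure.map_id] at this
      exact this.symm)
    (fun E w => E.1 ⊆ usedPairs f w ∧ E.2 ⊆ usedTriples z w) (by
      intro g E w h
      rw [hup, hut]
      exact ⟨Set.image_mono h.1, Set.image_mono h.2⟩)
  refine ⟨π, hπ, h1.trans hfst, h2.trans hsnd, ?_⟩
  have h4 : π.real {t | ¬ (t.1.1 ⊆ usedPairs f t.2 ∧ t.1.2 ⊆ usedTriples z t.2)} ≤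
      (ξ.prod (μ.prod ν)).real {t | ∃ g, t.1.1 ⊆ usedPairs f (b g t.2) ∧
        t.1.2 ⊆ usedTriples z (b g t.2)}ᶜ := by
    have h5 : {t : (Set (Finset (Fin n)) × Set (Finset (Fin n))) ×
        (Samples n m × (Fin m → Set (Fin n))) | ¬ (t.1.1 ⊆ usedPairs f t.2 ∧
          t.1.2 ⊆ usedTriples z t.2)} = {t | t.1.1 ⊆ (usedPairs f t.2 : Set (Finset (Fin n))) ∧
          t.1.2 ⊆ (usedTriples z t.2 : Set (Finset (Fin n)))}ᶜ := rfl
    rw [h5, probReal_compl_eq_one_sub .of_discrete, probReal_compl_eq_one_sub .of_discrete]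
    have := ENNReal.toReal_mono (measure_ne_top _ _) h3
    simp only [measureReal_def]
    linarith
  refine h4.trans ?_
  have hae : ∀ᵐ t ∂(ξ.prod (μ.prod ν)), (t.1.1 ⊆ {e | e.card = 2} ∧ t.1.2 ⊆ {e | e.card = 3}) ∧
      (∀ j, (t.2.1.1 j).card = 2) ∧ ∀ i, (t.2.1.2 i).card = 3 := by
    have q1 : ∀ᵐ x ∂μ, (∀ j, (x.1 j).card = 2) ∧ ∀ i, (x.2 i).card = 3 :=
      (Measure.quasiMeasurePreserving_fst.ae (ae_familyLaw_card (by omega) _)).and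
        (Measure.quasiMeasurePreserving_snd.ae (ae_familyLaw_card hn _))
    have q2 : ∀ᵐ E ∂ξ, E.1 ⊆ {e | e.card = 2} ∧ E.2 ⊆ {e | e.card = 3} :=
      (Measure.quasiMeasurePreserving_fst.ae (hypergraphLaw_ae_card 2 n q₂)).and
        (Measure.quasiMeasurePreserving_snd.ae (hypergraphLaw_ae_card 3 n q₃))
    exact (Measure.quasiMeasurePreserving_fst.ae q2).and
      (Measure.quasiMeasurePreserving_snd.ae (Measure.quasiMeasurePreserving_fst.ae q1))
  refine ENNReal.toReal_mono (measure_ne_top _ _) (measure_mono_ae ?_)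
  filter_upwards [hae] with t ht hbad hgood
  apply hbad
  obtain ⟨⟨hE2, hE3⟩, hx2, hx3⟩ := ht
  obtain ⟨g, hg2, hg3⟩ := exists_cardPerm (show 2 ≠ 3 by norm_num) hE2
    (t := usedPairs f t.2) (t' := usedTriples z t.2) (by
      intro e he
      simp only [usedPairs, Finset.coe_image, Set.mem_image] at he
      obtain ⟨j, _, rfl⟩ := he
      exact hx2 j) (by rw [Set.ncard_coe_finset]; exact hgood.1) hE3 (by
      intro e he
      simp only [usedTriples, Finset.coe_image, Set.mem_image] at he
      obtain ⟨j, _, rfl⟩ := he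
      exact hx3 j) (by rw [Set.ncard_coe_finset]; exact hgood.2)
  exact ⟨g, by rw [hup, hut]; exact ⟨hg2, hg3⟩⟩

theorem hyperedgeGraph_le_intersectionGraph {f z : ℕ → ℕ} {E E' : Set (Finset (Fin n))}
    {w : Samples n m × (Fin m → Set (Fin n))} {V : Fin m → Set (Fin n)}
    (hE : E ⊆ usedPairs f w) (hE' : E' ⊆ usedTriples z w) (hV : CoversSamples f z w V) :
    hyperedgeGraph E ⊔ hyperedgeGraph E' ≤ intersectionGraph V := by
  refine sup_le ?_ ?_
  · rintro v v' ⟨hne, e, he, hv, hv'⟩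
    obtain ⟨j, hj, rfl⟩ := Finset.mem_image.1 (Finset.mem_coe.1 (hE he))
    have := (hV j.1).1 j.2 hj
    exact ⟨hne, j.1, this hv, this hv'⟩
  · rintro v v' ⟨hne, e, he, hv, hv'⟩
    obtain ⟨j, hj, rfl⟩ := Finset.mem_image.1 (Finset.mem_coe.1 (hE' he))
    have := (hV j).2 hj
    exact ⟨hne, j, this hv, this hv'⟩

/-- The union of independent random graphs generated by pairs and triples can be coupled below the
random intersection graph, up to the probability that there are more hyperedges than distinct
pairs or triples that are used by the features. -/
theorem exists_coupling_unionLaw (hn : 3 ≤ n) (p : Fin m → ℝ) {f z : ℕ → ℕ}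
    (hfz : ∀ k, 2 * f k + 3 * z k ≤ k) (q₂ q₃ : ℝ) :
    ∃ π : Measure (SimpleGraph (Fin n) × SimpleGraph (Fin n)),
      IsProbabilityMeasure π ∧ π.map Prod.fst = unionLaw n q₂ q₃ ∧
      π.map Prod.snd = intersectionLaw n m p ∧
      π.real {G | ¬ G.1 ≤ G.2} ≤
        (((hypergraphLaw 2 n q₂).prod (hypergraphLaw 3 n q₃)).prod
          ((samplesLaw n m).prod (featureLaw n m p))).real
          {t | ¬ (t.1.1.ncard ≤ (usedPairs f t.2).card ∧
            t.1.2.ncard ≤ (usedTriples z t.2).card)} := by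
  have : DiscreteMeasurableSpace ((Set (Finset (Fin n)) × Set (Finset (Fin n))) ×
      (Samples n m × (Fin m → Set (Fin n)))) := inferInstance
  have : DiscreteMeasurableSpace (((Set (Finset (Fin n)) × Set (Finset (Fin n))) ×
      (Samples n m × (Fin m → Set (Fin n)))) × (Fin m → Set (Fin n))) :=
    MeasurableSingletonClass.toDiscreteMeasurableSpace
  obtain ⟨π₁, hπ₁, h11, h12, h13⟩ := exists_coupling_usedSamples hn p f z q₂ q₃
  obtain ⟨π₂, hπ₂, h21, h22, h23⟩ := exists_coupling_coversSamples hn p hfz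
  -- The shared marginal is the law of the samples together with the feature sizes' source.
  obtain ⟨τ, hτ, hτ1, hτ2⟩ := exists_glued_coupling π₁ π₂ (h12.trans h21.symm)
  let φ : ((Set (Finset (Fin n)) × Set (Finset (Fin n))) ×
      (Samples n m × (Fin m → Set (Fin n)))) × (Fin m → Set (Fin n)) →
      SimpleGraph (Fin n) × SimpleGraph (Fin n) :=
    fun t => (hyperedgeGraph t.1.1.1 ⊔ hyperedgeGraph t.1.1.2, intersectionGraph t.2)
  refine ⟨τ.map φ, Measure.isProbabilityMeasure_map Measurable.of_discrete.aemeasurable, ?_, ?_, ?_⟩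
  · have e1 : Prod.fst ∘ φ = (fun E : Set (Finset (Fin n)) × Set (Finset (Fin n)) =>
        hyperedgeGraph E.1 ⊔ hyperedgeGraph E.2) ∘ Prod.fst ∘ Prod.fst := rfl
    rw [Measure.map_map .of_discrete .of_discrete, e1, ← Measure.map_map .of_discrete .of_discrete,
      ← Measure.map_map .of_discrete .of_discrete, hτ1, h11, unionLaw, graphLaw, graphLaw,
      Measure.map_prod_map _ _ .of_discrete .of_discrete,
      Measure.map_map .of_discrete .of_discrete]
    rfl
  · have e1 : Prod.snd ∘ φ = intersectionGraph ∘ Prod.snd ∘ fun t => (t.1.2, t.2) := rfl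
    rw [Measure.map_map .of_discrete .of_discrete, e1, ← Measure.map_map .of_discrete .of_discrete,
      ← Measure.map_map .of_discrete .of_discrete, hτ2, h22]
    rfl
  · refine le_trans ?_ h13
    rw [map_measureReal_apply .of_discrete .of_discrete, ← hτ1,
      map_measureReal_apply .of_discrete .of_discrete]
    refine ENNReal.toReal_mono (measure_ne_top _ _) (measure_mono_ae ?_)
    have hae : ∀ᵐ t ∂τ, CoversSamples f z t.1.2 t.2 := by
      rw [← hτ2, Measure.map_apply .of_discrete .of_discrete,
        ← prob_compl_eq_zero_iff .of_discrete] at h23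
      exact h23
    filter_upwards [hae] with t ht hbad hgood
    exact hbad (hyperedgeGraph_le_intersectionGraph hgood.1 hgood.2 ht)

end FixedN

/-! ### Comparing the number of hyperedges with the number of samples -/

theorem prob_of_nonpos {q : ℝ} (hq : q ≤ 0) : prob q = 0 := Set.projIcc_of_le_left _ hq

theorem coe_prob_le {q : ℝ} (hq : 0 ≤ q) : (prob q : ℝ) ≤ q := by
  simp only [prob, Set.coe_projIcc]
  exact max_le hq (min_le_right _ _)

theorem coe_prob_of_mem {q : ℝ} (hq0 : 0 ≤ q) (hq1 : q ≤ 1) : (prob q : ℝ) = q := by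
  simp only [prob, Set.coe_projIcc]
  rw [min_eq_right hq1, max_eq_right hq0]

theorem ncard_card_eq (i n : ℕ) : {e : Finset (Fin n) | e.card = i}.ncard = n.choose i := by
  rw [← card_subsetsOfCard, ← Set.ncard_coe_finset]
  congr 1
  ext e
  simp [mem_subsetsOfCard]

/-- The number of hyperedges of a random uniform hypergraph exceeds its mean by at most `s`, up to
the Chebyshev error. -/
theorem hypergraphLaw_ncard_gt_le (i n : ℕ) {q s : ℝ} (hq : 0 ≤ q) (hs : 0 < s) :
    (hypergraphLaw i n q).real {E | n.choose i * q + s < E.ncard} ≤ n.choose i * q / s ^ 2 := by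
  have hmap := map_ncard_setBernoulli {e : Finset (Fin n) | e.card = i} (prob q)
  rw [ncard_card_eq] at hmap
  have hle : (n.choose i : ℝ) * prob q ≤ n.choose i * q := by
    have := coe_prob_le hq
    gcongr
  have hE : ∫ E, (E.ncard : ℝ) ∂(hypergraphLaw i n q) = n.choose i * prob q := by
    rw [← integral_binomial_id, ← hmap, integral_map (by fun_prop) (by fun_prop)]
    rfl
  refine measureReal_add_lt_le _ (fun E : Set (Finset (Fin n)) => (E.ncard : ℝ)) hs (hE.trans_le hle) ?_
  have := variance_binomial_id_le (n.choose i) (prob q)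
  rw [← hmap, variance_map (by fun_prop) (by fun_prop)] at this
  exact this.trans hle

/-- A set in a product has small measure if most of its sections have small measure. -/
theorem measureReal_prod_le_of_sections {X Y : Type*} [MeasurableSpace X] [MeasurableSpace Y]
    [Finite X] [Finite Y] [DiscreteMeasurableSpace X] [DiscreteMeasurableSpace Y]
    (μ : Measure X) (ν : Measure Y) [IsProbabilityMeasure μ] [IsProbabilityMeasure ν]
    (S : Set (X × Y)) (ε : ℝ) (hε : 0 ≤ ε) (h : ∀ y, μ.real {x | (x, y) ∈ S} ≤ ε) :
    (μ.prod ν).real S ≤ ε := by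
  refine ENNReal.toReal_le_of_le_ofReal hε ?_
  rw [Measure.prod_apply_symm .of_discrete]
  calc ∫⁻ y, μ ((fun x => (x, y)) ⁻¹' S) ∂ν ≤ ∫⁻ _, ENNReal.ofReal ε ∂ν := by
        refine lintegral_mono fun y => ?_
        rw [← ENNReal.ofReal_toReal (measure_ne_top μ _)]
        exact ENNReal.ofReal_le_ofReal (h y)
    _ = ENNReal.ofReal ε := by simp

section Comparison

variable {ι Ω : Type*} [Fintype ι] [Finite Ω] [MeasurableSpace Ω] [DiscreteMeasurableSpace Ω]

/-- A random number of independent uniform `i`-element sets, with mean `a` and variance `O(b)`,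
contains as many distinct sets as the random hypergraph has hyperedges, up to an error
`O(b / v²)`. -/
theorem ncard_hypergraph_gt_card_image_le {i n : ℕ} (hi : i ≤ n) (ν : Measure Ω)
    [IsProbabilityMeasure ν] (J : Ω → Finset ι) {a b v q : ℝ} (hv : 0 < v) (hab : a + 1 ≤ b)
    (hb : 0 ≤ b) (hmean : ∫ ω, ((J ω).card : ℝ) ∂ν = a)
    (hvar : Var[fun ω => ((J ω).card : ℝ); ν] ≤ 2 * b)
    (hq : q ≤ 0 ∨ n.choose i * q ≤ a - v - (a + 1) ^ 2 / (2 * n.choose i)) :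
    ((hypergraphLaw i n q).prod ((familyLaw i n ι).prod ν)).real
      {t | ((J t.2.2).image t.2.1).card < t.1.ncard} ≤ 36 * b / v ^ 2 := by
  classical
  have hF := isProbabilityMeasure_familyLaw hi ι
  set c : ℝ := (n.choose i : ℝ) with hc
  have hc0 : 0 < c := by rw [hc]; exact_mod_cast Nat.choose_pos hi
  rcases le_or_gt q 0 with hq0 | hq0
  · have hae : ∀ᵐ t ∂((hypergraphLaw i n q).prod ((familyLaw i n ι).prod ν)), t.1 = ∅ := by
      refine Measure.quasiMeasurePreserving_fst.ae (p := fun E => E = ∅) ?_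
      rw [hypergraphLaw, prob_of_nonpos hq0, setBernoulli_zero]
      simp [ae_dirac_eq]
    have h0 : ((hypergraphLaw i n q).prod ((familyLaw i n ι).prod ν)).real
        {t | ((J t.2.2).image t.2.1).card < t.1.ncard} = 0 := by
      rw [measureReal_def, (measure_mono_null (fun t ht h => ?_) (ae_iff.1 hae)),
        ENNReal.toReal_zero]
      simp [h] at ht
    rw [h0]
    positivity
  · replace hq := hq.resolve_left (not_le.2 hq0)
    have hcq : 0 < c * q := by positivity
    have hpos : 0 ≤ (a + 1) ^ 2 / (2 * c) := by positivity
    -- The slack `v` is split equally among three deviations: too many hyperedges, too few samples,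
    -- too many repetitions. They cost b/s², 2b/s² and b/s², whence 36 = 4 · 9.
    set s := v / 3 with hs
    have hs0 : 0 < s := by positivity
    have hvs : v = 3 * s := by rw [hs]; ring
    -- A deterministic number of samples; extra samples only add values. Rounding up is the source
    -- of the `a + 1` in the collision term.
    set l : ℕ := ⌈a - s⌉₊ with hl
    have hl1 : a - s ≤ l := Nat.le_ceil _
    have hl2 : (l : ℝ) ≤ a + 1 := by
      have := (Nat.ceil_lt_add_one (show 0 ≤ a - s by linarith)).le
      linarith
    have hl3 : (l : ℝ) ^ 2 / (2 * c) ≤ (a + 1) ^ 2 / (2 * c) := by gcongr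
    have b1 : ((hypergraphLaw i n q).prod ((familyLaw i n ι).prod ν)).real
        {t | c * q + s < t.1.ncard} ≤ b / s ^ 2 := by
      have := measurePreserving_fst (μ := hypergraphLaw i n q) (ν := (familyLaw i n ι).prod ν)
        |>.measureReal_preimage (s := {E | c * q + s < E.ncard})
          (MeasurableSet.of_discrete).nullMeasurableSet
      refine (this.trans_le (hypergraphLaw_ncard_gt_le i n hq0.le hs0)).trans ?_
      gcongr
      linarith
    have b2 : ((hypergraphLaw i n q).prod ((familyLaw i n ι).prod ν)).real
        {t | ((J t.2.2).card : ℝ) < a - s} ≤ 2 * b / s ^ 2 := by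
      have := (measurePreserving_snd (μ := familyLaw i n ι) (ν := ν)).comp
        (measurePreserving_snd (μ := hypergraphLaw i n q) (ν := (familyLaw i n ι).prod ν))
        |>.measureReal_preimage (s := {ω | ((J ω).card : ℝ) < a - s})
          (MeasurableSet.of_discrete).nullMeasurableSet
      exact this.trans_le (measureReal_lt_sub_le ν _ hs0 hmean.ge hvar)
    have b3 : ((hypergraphLaw i n q).prod ((familyLaw i n ι).prod ν)).real
        {t | l ≤ (J t.2.2).card ∧
          (((J t.2.2).image t.2.1).card : ℝ) < l - l ^ 2 / (2 * c) - s} ≤ b / s ^ 2 := by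
      have := (measurePreserving_snd (μ := hypergraphLaw i n q) (ν := (familyLaw i n ι).prod ν))
        |>.measureReal_preimage (s := {w | l ≤ (J w.2).card ∧
          (((J w.2).image w.1).card : ℝ) < l - l ^ 2 / (2 * c) - s})
          (MeasurableSet.of_discrete).nullMeasurableSet
      refine this.trans_le (measureReal_prod_le_of_sections _ _ _ _ (by positivity) fun ω => ?_)
      by_cases hω : l ≤ (J ω).card
      · obtain ⟨J', hJ', hJ'l⟩ := Finset.exists_subset_card_eq hω
        have h1 := pi_uniformOn_card_image_lt_le (subsetsOfCard i n) (subsetsOfCard_nonempty hi) J'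
          hs0
        rw [hJ'l, card_subsetsOfCard, ← hc] at h1
        refine (measureReal_mono fun x hx => ?_).trans (h1.trans ?_)
        · have h2 : ((J'.image x).card : ℝ) ≤ ((J ω).image x).card := by
            exact_mod_cast Finset.card_le_card (Finset.image_subset_image hJ')
          exact h2.trans_lt hx.2
        · gcongr
          linarith
      · have : {x : ι → Finset (Fin n) | (x, ω) ∈ {w : (ι → Finset (Fin n)) × Ω |
            l ≤ (J w.2).card ∧ (((J w.2).image w.1).card : ℝ) < l - l ^ 2 / (2 * c) - s}} = ∅ := by
          ext x; simp [hω]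
        rw [this]
        simp only [measureReal_empty]
        positivity
    have hsub : {t : Set (Finset (Fin n)) × ((ι → Finset (Fin n)) × Ω) |
        ((J t.2.2).image t.2.1).card < t.1.ncard} ⊆
        ({t | c * q + s < t.1.ncard} ∪ {t | ((J t.2.2).card : ℝ) < a - s}) ∪
        {t | l ≤ (J t.2.2).card ∧
          (((J t.2.2).image t.2.1).card : ℝ) < l - l ^ 2 / (2 * c) - s} := by
      intro t ht
      have ht' : (((J t.2.2).image t.2.1).card : ℝ) < t.1.ncard := by exact_mod_cast ht
      by_contra hcon
      simp only [Set.mem_union, Set.mem_ofPred_eq, not_or, not_and, not_lt] at hcon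
      obtain ⟨⟨h1, h2⟩, h3⟩ := hcon
      have := h3 (Nat.ceil_le.2 h2)
      linarith
    refine (measureReal_mono hsub).trans ((measureReal_union_le _ _).trans
      ((add_le_add (measureReal_union_le _ _) le_rfl).trans
      ((add_le_add (add_le_add b1 b2) b3).trans (le_of_eq ?_))))
    rw [hvs]
    field_simp
    ring

end Comparison

/-! ### Sums over the features -/

theorem integral_featureLaw_sum {n m : ℕ} (p : Fin m → ℝ) (g : ℕ → ℕ) :
    ∫ V, ((∑ i, g (V i).ncard : ℕ) : ℝ) ∂(featureLaw n m p) =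
      ∑ i, ∫ k, (g k : ℝ) ∂(binomial n (prob (p i))) := by
  push_cast
  rw [integral_finsetSum _ fun _ _ => .of_finite]
  refine Finset.sum_congr rfl fun i _ => ?_
  have hmap := map_ncard_setBernoulli (Set.univ : Set (Fin n)) (prob (p i))
  rw [Set.ncard_univ, Nat.card_eq_fintype_card, Fintype.card_fin] at hmap
  rw [← hmap, integral_map (by fun_prop) (by fun_prop)]
  have h1 := measurePreserving_eval
    (fun i : Fin m => setBernoulli (Set.univ : Set (Fin n)) (prob (p i))) i
  rw [← h1.map_eq, integral_map h1.aemeasurable Measurable.of_discrete.aestronglyMeasurable]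
  rfl

theorem variance_featureLaw_sum {n m : ℕ} (p : Fin m → ℝ) (g : ℕ → ℕ) :
    Var[fun V => ((∑ i, g (V i).ncard : ℕ) : ℝ); featureLaw n m p] =
      ∑ i, Var[fun k => (g k : ℝ); binomial n (prob (p i))] := by
  have h := variance_sum_pi (μ := fun i : Fin m => setBernoulli (Set.univ : Set (Fin n))
    (prob (p i))) (X := fun _ V => (g V.ncard : ℝ)) fun i => memLp_of_finite _ _
  have h1 : (fun V : Fin m → Set (Fin n) => ((∑ i, g (V i).ncard : ℕ) : ℝ)) =
      ∑ i, fun V : Fin m → Set (Fin n) => (g (V i).ncard : ℝ) := by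
    ext V; simp
  rw [h1, featureLaw, h]
  refine Finset.sum_congr rfl fun i _ => ?_
  have hmap := map_ncard_setBernoulli (Set.univ : Set (Fin n)) (prob (p i))
  rw [Set.ncard_univ, Nat.card_eq_fintype_card, Fintype.card_fin] at hmap
  rw [← hmap, variance_map (by fun_prop) (by fun_prop)]
  rfl

/-- A quantitative form of the coupling for a fixed number of vertices, in which a feature with `k`
vertices is used for `f k` pairs and `z k` triples. -/
theorem exists_coupling_unionLaw_of_moments {n m : ℕ} (hn : 3 ≤ n) (p : Fin m → ℝ) {f z : ℕ → ℕ}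
    (hfz : ∀ k, 2 * f k + 3 * z k ≤ k) (hz : ∀ k, z k ≤ 1) {q₂ q₃ a₂ a₃ b v : ℝ} (hv : 0 < v)
    (hb : 0 ≤ b) (hab₂ : a₂ + 1 ≤ b) (hab₃ : a₃ + 1 ≤ b)
    (hmean₂ : ∑ i, ∫ k, (f k : ℝ) ∂(binomial n (prob (p i))) = a₂)
    (hmean₃ : ∑ i, ∫ k, (z k : ℝ) ∂(binomial n (prob (p i))) = a₃)
    (hvar₂ : ∑ i, Var[fun k => (f k : ℝ); binomial n (prob (p i))] ≤ 2 * b)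
    (hvar₃ : ∑ i, Var[fun k => (z k : ℝ); binomial n (prob (p i))] ≤ 2 * b)
    (hq₂ : q₂ ≤ 0 ∨ n.choose 2 * q₂ ≤ a₂ - v - (a₂ + 1) ^ 2 / (2 * n.choose 2))
    (hq₃ : q₃ ≤ 0 ∨ n.choose 3 * q₃ ≤ a₃ - v - (a₃ + 1) ^ 2 / (2 * n.choose 3)) :
    ∃ π : Measure (SimpleGraph (Fin n) × SimpleGraph (Fin n)),
      IsProbabilityMeasure π ∧ π.map Prod.fst = unionLaw n q₂ q₃ ∧
      π.map Prod.snd = intersectionLaw n m p ∧ π.real {G | ¬ G.1 ≤ G.2} ≤ 72 * b / v ^ 2 := by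
  obtain ⟨π, hπ, h1, h2, h3⟩ := exists_coupling_unionLaw hn p hfz q₂ q₃
  refine ⟨π, hπ, h1, h2, h3.trans ?_⟩
  have := isProbabilityMeasure_familyLaw (show 2 ≤ n by omega) (Fin m × Fin n)
  have := isProbabilityMeasure_familyLaw hn (Fin m)
  have := isProbabilityMeasure_samplesLaw hn m
  have hf (k : ℕ) : f k ≤ k := by have := hfz k; omega
  have c2 := ncard_hypergraph_gt_card_image_le (show 2 ≤ n by omega) (featureLaw n m p)
    (pairIndices f) (q := q₂) hv hab₂ hb
    (by simp_rw [card_pairIndices f hf]; rw [integral_featureLaw_sum, hmean₂])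
    (by simp_rw [card_pairIndices f hf]; rw [variance_featureLaw_sum]; exact hvar₂) hq₂
  have c3 := ncard_hypergraph_gt_card_image_le hn (featureLaw n m p)
    (tripleIndices z) (q := q₃) hv hab₃ hb
    (by simp_rw [card_tripleIndices z hz]; rw [integral_featureLaw_sum, hmean₃])
    (by simp_rw [card_tripleIndices z hz]; rw [variance_featureLaw_sum]; exact hvar₃) hq₃
  have m2 := (measurePreserving_fst (μ := hypergraphLaw 2 n q₂) (ν := hypergraphLaw 3 n q₃)).prod
    ((measurePreserving_fst (μ := familyLaw 2 n (Fin m × Fin n)) (ν := familyLaw 3 n (Fin m))).prod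
      (MeasurePreserving.id (featureLaw n m p)))
  have m3 := (measurePreserving_snd (μ := hypergraphLaw 2 n q₂) (ν := hypergraphLaw 3 n q₃)).prod
    ((measurePreserving_snd (μ := familyLaw 2 n (Fin m × Fin n)) (ν := familyLaw 3 n (Fin m))).prod
      (MeasurePreserving.id (featureLaw n m p)))
  rw [← m2.measureReal_preimage (MeasurableSet.of_discrete).nullMeasurableSet] at c2
  rw [← m3.measureReal_preimage (MeasurableSet.of_discrete).nullMeasurableSet] at c3
  have hsum : 72 * b / v ^ 2 = 36 * b / v ^ 2 + 36 * b / v ^ 2 := by ring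
  rw [hsum]
  refine le_trans (measureReal_mono ?_) ((measureReal_union_le _ _).trans (add_le_add c2 c3))
  intro t ht
  simp only [Set.mem_ofPred_eq, not_and_or, not_le] at ht
  exact ht

/-! ### The parameters as expected values -/

section Parameters

variable {n m : ℕ} {p : Fin m → ℝ}

/-- Each summand of S₂ is a mean size minus the probability of odd size, that is, the mean number of
matched vertices. -/
theorem S₂_eq (hn : n ≠ 0) (hp : ∀ i, 0 < p i ∧ p i < 1) :
    S₂ n m p = 2 * ∑ i, ∫ k, ((k / 2 : ℕ) : ℝ) ∂(binomial n (prob (p i))) := by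
  rw [S₂, Finset.mul_sum]
  refine Finset.sum_congr rfl fun i _ => ?_
  rw [two_mul_integral_binomial_half, coe_prob_of_mem (hp i).1.le (hp i).2.le]
  have h1 : (n : ℝ) ≠ 0 := by exact_mod_cast hn
  have h2 := (hp i).1.ne'
  field_simp

theorem S₃_eq (hn : n ≠ 0) (hp : ∀ i, 0 < p i ∧ p i < 1) :
    S₃ n m p = ∑ i, ∫ k, (oddTriple k : ℝ) ∂(binomial n (prob (p i))) := by
  rw [S₃]
  refine Finset.sum_congr rfl fun i _ => ?_
  rw [integral_binomial_oddTriple, coe_prob_of_mem (hp i).1.le (hp i).2.le]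
  have h1 : (n : ℝ) ≠ 0 := by exact_mod_cast hn
  have h2 := (hp i).1.ne'
  field_simp

theorem S₁_eq_add : S₁ n m p = S₂ n m p + S₃ n m p := by
  rw [S₁, S₂, S₃, ← Finset.sum_add_distrib]
  refine Finset.sum_congr rfl fun i _ => ?_
  ring

theorem S₃_nonneg (hn : n ≠ 0) (hp : ∀ i, 0 < p i ∧ p i < 1) : 0 ≤ S₃ n m p := by
  rw [S₃_eq hn hp]
  exact Finset.sum_nonneg fun i _ => integral_nonneg fun k => Nat.cast_nonneg _

/-- An odd feature of size at least three contains a pair. Consequently S₂ ≥ 2S₁/3. -/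
theorem two_mul_S₃_le (hn : n ≠ 0) (hp : ∀ i, 0 < p i ∧ p i < 1) :
    2 * S₃ n m p ≤ S₂ n m p := by
  rw [S₃_eq hn hp, S₂_eq hn hp]
  refine mul_le_mul_of_nonneg_left (Finset.sum_le_sum fun i _ => ?_) zero_le_two
  refine integral_mono (integrable_binomial _) (integrable_binomial _) fun k => ?_
  exact Nat.cast_le.2 (oddTriple_le_half k)

/-- The collision loss for pairs fits into half of the term 2s²/n² of the parameter. The bound 5
gives (s/2 + 1)² ≤ s²/2, which absorbs the rounding. -/
theorem sq_div_choose_two_le {a s : ℝ} (hn : 2 ≤ n) (hs : 5 ≤ s) (ha0 : 0 ≤ a)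
    (ha : a ≤ s / 2) : (a + 1) ^ 2 / (2 * n.choose 2) ≤ s ^ 2 / n ^ 2 := by
  have hn' : (2 : ℝ) ≤ n := by exact_mod_cast hn
  rw [Nat.cast_choose_two, div_le_div_iff₀ (by nlinarith) (by positivity)]
  have h1 : (a + 1) ^ 2 ≤ s ^ 2 / 2 := by nlinarith
  have h2 : (n : ℝ) ^ 2 ≤ 2 * (n * (n - 1)) := by nlinarith
  calc (a + 1) ^ 2 * (n : ℝ) ^ 2 ≤ s ^ 2 / 2 * (2 * (n * (n - 1))) := by gcongr
    _ = _ := by ring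

theorem sq_div_choose_three_le {s : ℝ} (hn : 12 ≤ n) (hs : 10 ≤ s) :
    (s + 1) ^ 2 / (2 * n.choose 3) ≤ 6 * s ^ 2 / n ^ 3 := by
  have hn' : (12 : ℝ) ≤ n := by exact_mod_cast hn
  have hc : (n.choose 3 : ℝ) = n * (n - 1) * (n - 2) / 6 := by
    rw [Nat.cast_choose_eq_ascPochhammer_div]
    have : ((n - (3 - 1) : ℕ) : ℝ) = n - 2 := by
      rw [Nat.cast_sub (by omega)]; norm_num
    rw [this]
    simp [ascPochhammer_succ_right, Nat.factorial]
    ring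
  have hpos : 0 < (n : ℝ) * (n - 1) * (n - 2) := by
    have h1 : (0 : ℝ) < n - 1 := by linarith
    have h2 : (0 : ℝ) < n - 2 := by linarith
    positivity
  rw [hc, div_le_div_iff₀ (by linarith) (by positivity)]
  have h1 : (s + 1) ^ 2 ≤ 121 / 100 * s ^ 2 := by nlinarith
  have h2 : 121 / 100 * (n : ℝ) ^ 2 ≤ 2 * ((n - 1) * (n - 2)) := by nlinarith
  calc (s + 1) ^ 2 * (n : ℝ) ^ 3 ≤ 121 / 100 * s ^ 2 * (n : ℝ) ^ 3 := by gcongr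
    _ = s ^ 2 * n * (121 / 100 * (n : ℝ) ^ 2) := by ring
    _ ≤ s ^ 2 * n * (2 * ((n - 1) * (n - 2))) := by gcongr
    _ = _ := by ring

/-- The coupling that uses the pairs of a maximal matching of each feature. -/
theorem exists_coupling_pairs (hn : 3 ≤ n) (hp : ∀ i, 0 < p i ∧ p i < 1) {b v q s : ℝ}
    (hv : 0 < v) (hS : 5 ≤ s) (hs : S₂ n m p ≤ s) (hb : s ≤ b)
    (hq : n.choose 2 * q ≤ S₂ n m p / 2 - v - s ^ 2 / n ^ 2) :
    ∃ π : Measure (SimpleGraph (Fin n) × SimpleGraph (Fin n)),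
      IsProbabilityMeasure π ∧ π.map Prod.fst = unionLaw n q 0 ∧
      π.map Prod.snd = intersectionLaw n m p ∧ π.real {G | ¬ G.1 ≤ G.2} ≤ 72 * b / v ^ 2 := by
  have h2 := S₂_eq (show n ≠ 0 by omega) hp
  have h0 : 0 ≤ S₂ n m p := by
    have := S₃_nonneg (show n ≠ 0 by omega) hp
    have := two_mul_S₃_le (show n ≠ 0 by omega) hp
    linarith
  -- The free bound `s` will be S₂ for the binomial graph and S₁ when S₃ = O(√S₁).
  refine exists_coupling_unionLaw_of_moments hn p (f := fun k => k / 2) (z := fun _ => 0)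
    (fun k => by omega) (fun k => by omega) (a₂ := S₂ n m p / 2) (a₃ := 0) hv (by linarith)
    (by linarith) (by linarith) (by rw [h2]; ring) (by simp) ?_ ?_ (Or.inr ?_) (Or.inl le_rfl)
  · refine (Finset.sum_le_sum fun i _ => variance_binomial_half_le n (prob (p i))).trans ?_
    rw [← Finset.mul_sum, ← h2]
    linarith
  · simp only [Nat.cast_zero]
    have hz (i : Fin m) : Var[fun _ : ℕ => (0 : ℝ); binomial n (prob (p i))] = 0 :=
      variance_zero _
    simp only [hz, Finset.sum_const_zero]
    linarith
  · have := sq_div_choose_two_le (n := n) (by omega) hS (a := S₂ n m p / 2) (by linarith)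
      (by linarith)
    linarith

/-- The coupling that uses a triple in each feature of odd size. -/
theorem exists_coupling_triples (hn : 12 ≤ n) (hp : ∀ i, 0 < p i ∧ p i < 1) {v q₂ q₃ : ℝ}
    (hv : 0 < v) (hS : 10 ≤ S₃ n m p)
    (hq₂ : n.choose 2 * q₂ ≤ (S₁ n m p - 3 * S₃ n m p) / 2 - v - S₁ n m p ^ 2 / n ^ 2)
    (hq₃ : n.choose 3 * q₃ ≤ S₃ n m p - v - 6 * S₃ n m p ^ 2 / n ^ 3) :
    ∃ π : Measure (SimpleGraph (Fin n) × SimpleGraph (Fin n)),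
      IsProbabilityMeasure π ∧ π.map Prod.fst = unionLaw n q₂ q₃ ∧
      π.map Prod.snd = intersectionLaw n m p ∧
      π.real {G | ¬ G.1 ≤ G.2} ≤ 72 * S₁ n m p / v ^ 2 := by
  have h2 := S₂_eq (show n ≠ 0 by omega) hp
  have h3 := S₃_eq (show n ≠ 0 by omega) hp
  have h1 := S₁_eq_add (n := n) (m := m) (p := p)
  have h23 := two_mul_S₃_le (show n ≠ 0 by omega) hp
  refine exists_coupling_unionLaw_of_moments (by omega) p (f := fun k => k / 2 - oddTriple k)
    (z := oddTriple) two_mul_half_sub_add_le oddTriple_le_one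
    -- The mean number of pairs is S₂/2 - S₃, and S₂ = S₁ - S₃.
    (a₂ := (S₁ n m p - 3 * S₃ n m p) / 2) (a₃ := S₃ n m p) hv (by linarith)
    (by linarith) (by linarith) ?_ h3.symm ?_ ?_ (Or.inr ?_) (Or.inr ?_)
  · have h4 (i : Fin m) : ∫ k, ((k / 2 - oddTriple k : ℕ) : ℝ) ∂(binomial n (prob (p i))) =
        ∫ k, ((k / 2 : ℕ) : ℝ) ∂(binomial n (prob (p i))) -
          ∫ k, (oddTriple k : ℝ) ∂(binomial n (prob (p i))) := by
      rw [← integral_sub (integrable_binomial _) (integrable_binomial _)]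
      congr 1
      ext k
      rw [Nat.cast_sub (oddTriple_le_half k)]
    simp_rw [h4]
    rw [Finset.sum_sub_distrib, ← h3, h1, h2]
    ring
  · refine (Finset.sum_le_sum fun i _ => variance_binomial_half_sub_le n (prob (p i))).trans ?_
    rw [Finset.sum_add_distrib, ← Finset.mul_sum, ← Finset.mul_sum, ← h3]
    linarith
  · refine (Finset.sum_le_sum fun i _ => variance_binomial_oddTriple_le n (prob (p i))).trans ?_
    rw [← h3]
    linarith
  · have := sq_div_choose_two_le (n := n) (by omega) (s := S₁ n m p) (by linarith)
      (a := (S₁ n m p - 3 * S₃ n m p) / 2) (by linarith) (by linarith)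
    linarith
  · have := sq_div_choose_three_le hn hS
    linarith

end Parameters

/-! ### Limits -/

instance isProbabilityMeasure_graphLaw (i n : ℕ) (q : ℝ) : IsProbabilityMeasure (graphLaw i n q) :=
  Measure.isProbabilityMeasure_map Measurable.of_discrete.aemeasurable

instance isProbabilityMeasure_unionLaw (n : ℕ) (q₂ q₃ : ℝ) :
    IsProbabilityMeasure (unionLaw n q₂ q₃) :=
  Measure.isProbabilityMeasure_map Measurable.of_discrete.aemeasurable

instance isProbabilityMeasure_intersectionLaw (n m : ℕ) (p : Fin m → ℝ) :
    IsProbabilityMeasure (intersectionLaw n m p) :=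
  Measure.isProbabilityMeasure_map Measurable.of_discrete.aemeasurable

theorem hyperedgeGraph_empty (n : ℕ) : hyperedgeGraph (∅ : Set (Finset (Fin n))) = ⊥ := by
  ext v w
  simp [hyperedgeGraph]

theorem unionLaw_zero (n : ℕ) (q : ℝ) : unionLaw n q 0 = graphLaw 2 n q := by
  have h : graphLaw 3 n 0 = Measure.dirac ⊥ := by
    rw [graphLaw, hypergraphLaw, prob_of_nonpos le_rfl, setBernoulli_zero,
      Measure.map_dirac' .of_discrete, hyperedgeGraph_empty]
  rw [unionLaw, h, Measure.prod_dirac, Measure.map_map .of_discrete .of_discrete]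
  have h1 : ((fun G : SimpleGraph (Fin n) × SimpleGraph (Fin n) => G.1 ⊔ G.2) ∘ fun x => (x, ⊥)) =
      id := by
    ext1 G
    simp
  rw [h1, Measure.map_id]

/-- Only large `n` matter: the independent coupling serves the others. For an increasing family, the
two probabilities differ in the wrong direction by at most the failure probability. -/
theorem couplingConclusion_of_eventually {μ ν : ∀ n : ℕ, Measure (SimpleGraph (Fin n))}
    [∀ n, IsProbabilityMeasure (μ n)] [∀ n, IsProbabilityMeasure (ν n)] {ε : ℕ → ℝ}
    (hε : Tendsto ε atTop (𝓝 0))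
    (h : ∀ᶠ n in atTop, ∃ π : Measure (SimpleGraph (Fin n) × SimpleGraph (Fin n)),
      IsProbabilityMeasure π ∧ π.map Prod.fst = μ n ∧ π.map Prod.snd = ν n ∧
      π.real {G | ¬ G.1 ≤ G.2} ≤ ε n) :
    CouplingConclusion μ ν := by
  have hex (n : ℕ) : ∃ π : Measure (SimpleGraph (Fin n) × SimpleGraph (Fin n)),
      (IsProbabilityMeasure π ∧ π.map Prod.fst = μ n ∧ π.map Prod.snd = ν n) ∧
      ((∃ π : Measure (SimpleGraph (Fin n) × SimpleGraph (Fin n)),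
        IsProbabilityMeasure π ∧ π.map Prod.fst = μ n ∧ π.map Prod.snd = ν n ∧
        π.real {G | ¬ G.1 ≤ G.2} ≤ ε n) → π.real {G | ¬ G.1 ≤ G.2} ≤ ε n) := by
    by_cases hn : ∃ π : Measure (SimpleGraph (Fin n) × SimpleGraph (Fin n)),
        IsProbabilityMeasure π ∧ π.map Prod.fst = μ n ∧ π.map Prod.snd = ν n ∧
        π.real {G | ¬ G.1 ≤ G.2} ≤ ε n
    · obtain ⟨π, h1, h2, h3, h4⟩ := hn
      exact ⟨π, ⟨h1, h2, h3⟩, fun _ => h4⟩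
    · exact ⟨(μ n).prod (ν n), ⟨inferInstance, Measure.fst_prod, Measure.snd_prod⟩,
        fun h => absurd h hn⟩
  choose π hπ hπε using hex
  have hprob (n : ℕ) : IsProbabilityMeasure (π n) := (hπ n).1
  have hbad : Tendsto (fun n => (π n).real {G | ¬ G.1 ≤ G.2}) atTop (𝓝 0) :=
    squeeze_zero' (Eventually.of_forall fun n => measureReal_nonneg) (h.mono fun n => hπε n) hε
  refine ⟨⟨π, hπ, ?_⟩, fun A hA => ?_⟩
  · have h1 (n : ℕ) : π n {G | G.1 ≤ G.2} =
        ENNReal.ofReal (1 - (π n).real {G | ¬ G.1 ≤ G.2}) := by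
      have : {G : SimpleGraph (Fin n) × SimpleGraph (Fin n) | ¬ G.1 ≤ G.2} =
        {G | G.1 ≤ G.2}ᶜ := rfl
      rw [this, probReal_compl_eq_one_sub .of_discrete, sub_sub_cancel, measureReal_def,
        ENNReal.ofReal_toReal (measure_ne_top _ _)]
    simp_rw [h1]
    have := ENNReal.tendsto_ofReal (hbad.const_sub 1)
    simpa using this
  · have hle (n : ℕ) : μ n (A n) ≤ ν n (A n) + π n {G | ¬ G.1 ≤ G.2} := by
      rw [← (hπ n).2.1, ← (hπ n).2.2, Measure.map_apply .of_discrete .of_discrete,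
        Measure.map_apply .of_discrete .of_discrete]
      refine (measure_mono fun G hG => ?_).trans (measure_union_le _ _)
      by_cases hle : G.1 ≤ G.2
      · exact Or.inl ((hA n).2 _ hG _ hle)
      · exact Or.inr hle
    have hbad' : Tendsto (fun n => π n {G | ¬ G.1 ≤ G.2}) atTop (𝓝 0) := by
      have := ENNReal.tendsto_ofReal hbad
      simpa [measureReal_def, ENNReal.ofReal_toReal (measure_ne_top _ _)] using this
    refine le_of_forall_gt_imp_ge_of_dense fun c hc => ?_
    -- The intermediate `d` leaves a positive gap `c - d` for the failure probability.
    obtain ⟨d, hd1, hd2⟩ := exists_between hc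
    have h1 : ∀ᶠ n in atTop, ν n (A n) < d := eventually_lt_of_limsup_lt hd1
    have h2 : ∀ᶠ n in atTop, π n {G | ¬ G.1 ≤ G.2} < c - d :=
      (tendsto_order.1 hbad').2 _ (tsub_pos_of_lt hd2)
    refine le_trans liminf_le_limsup (limsup_le_of_le (h := ?_))
    filter_upwards [h1, h2] with n hn1 hn2
    calc μ n (A n) ≤ d + (c - d) := (hle n).trans (add_le_add hn1.le hn2.le)
      _ = c := add_tsub_cancel_of_le hd2.le

theorem tendsto_const_div_sq {ω : ℕ → ℝ} (hω : Tendsto ω atTop atTop) (c : ℝ) :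
    Tendsto (fun n => c / ω n ^ 2) atTop (𝓝 0) :=
  tendsto_const_nhds.div_atTop ((tendsto_pow_atTop two_ne_zero).comp hω)

/-- For the slack v = w√s/2 the size of s cancels, so any w → ∞ suffices. -/
theorem error_eq {s w : ℝ} (hs : 0 < s) (hw : 0 < w) :
    72 * s / (w * √s / 2) ^ 2 = 288 / w ^ 2 := by
  rw [div_pow, mul_pow, Real.sq_sqrt hs.le]
  field_simp
  norm_num

theorem choose_mul_div {n i : ℕ} (h : i ≤ n) (x : ℝ) : n.choose i * (x / n.choose i) = x := by
  have : (n.choose i : ℝ) ≠ 0 := by exact_mod_cast (Nat.choose_pos h).ne'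
  field_simp

theorem choose_two_mul_div {n : ℕ} (h : 2 ≤ n) (x : ℝ) :
    n.choose 2 * (x / (2 * n.choose 2)) = x / 2 := by
  rw [← div_div, choose_mul_div h]

end RIG

/-! ### The coupling theorem -/

theorem mainTheorem1 (m : ℕ → ℕ) (p : ∀ n : ℕ, Fin (m n) → ℝ)
    (hp : ∀ n i, 0 < p n i ∧ p n i < 1)
    (hS₁ : Tendsto (fun n => RIG.S₁ n (m n) (p n)) atTop atTop)
    (hS₁' : (fun n => RIG.S₁ n (m n) (p n)) =o[atTop] fun n : ℕ => (n : ℝ) ^ 2)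
    (ω : ℕ → ℝ) (hω : Tendsto ω atTop atTop) :
    RIG.CouplingConclusion
      (fun n => RIG.graphLaw 2 n (RIG.pHat n (RIG.S₂ n (m n) (p n)) (ω n)))
      (fun n => RIG.intersectionLaw n (m n) (p n)) ∧
    ((fun n => √(RIG.S₁ n (m n) (p n))) =o[atTop] (fun n => RIG.S₃ n (m n) (p n)) →
      (fun n => ω n ^ 2) =o[atTop]
        (fun n => RIG.S₃ n (m n) (p n) / √(RIG.S₁ n (m n) (p n))) →
      RIG.CouplingConclusion
        (fun n => RIG.unionLaw n
          (RIG.pHat₂ n (RIG.S₁ n (m n) (p n)) (RIG.S₃ n (m n) (p n)) (ω n))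
          (RIG.pHat₃ n (RIG.S₁ n (m n) (p n)) (RIG.S₃ n (m n) (p n)) (ω n)))
        (fun n => RIG.intersectionLaw n (m n) (p n))) ∧
    ((fun n => RIG.S₃ n (m n) (p n)) =O[atTop] (fun n => √(RIG.S₁ n (m n) (p n))) →
      RIG.CouplingConclusion
        (fun n => RIG.unionLaw n (RIG.pHat n (RIG.S₁ n (m n) (p n)) (ω n)) 0)
        (fun n => RIG.intersectionLaw n (m n) (p n))) := by
  refine ⟨?_, fun hS₃ _ => ?_, fun hS₃ => ?_⟩
  · simp_rw [← RIG.unionLaw_zero]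
    refine RIG.couplingConclusion_of_eventually (RIG.tendsto_const_div_sq hω 288) ?_
    filter_upwards [hS₁.eventually_ge_atTop 10, hω.eventually_gt_atTop 0,
      eventually_ge_atTop 3] with n hSn hωn hn
    have h1 := RIG.S₁_eq_add (n := n) (m := m n) (p := p n)
    have h23 := RIG.two_mul_S₃_le (show n ≠ 0 by omega) (hp n)
    have hS : 5 ≤ RIG.S₂ n (m n) (p n) := by linarith
    have hpos : 0 < RIG.S₂ n (m n) (p n) := by linarith
    rw [← RIG.error_eq hpos hωn]
    refine RIG.exists_coupling_pairs hn (hp n) (by positivity) hS le_rfl le_rfl ?_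
    rw [RIG.pHat, RIG.choose_two_mul_div (by omega)]
    apply le_of_eq
    ring
  · refine RIG.couplingConclusion_of_eventually (RIG.tendsto_const_div_sq hω 288) ?_
    -- This gives S₃ ≥ 10√S₁ ≥ 10 for large `n`, the size that `exists_coupling_triples` needs.
    have hev := hS₃.bound (show (0 : ℝ) < 1 / 10 by norm_num)
    filter_upwards [hS₁.eventually_ge_atTop 1, hω.eventually_gt_atTop 0,
      eventually_ge_atTop 12, hev] with n hSn hωn hn hev
    have h30 := RIG.S₃_nonneg (show n ≠ 0 by omega) (hp n)
    rw [Real.norm_of_nonneg (Real.sqrt_nonneg _), Real.norm_of_nonneg h30] at hev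
    have hsq : 1 ≤ √(RIG.S₁ n (m n) (p n)) := Real.one_le_sqrt.2 hSn
    have hpos : 0 < RIG.S₁ n (m n) (p n) := by linarith
    rw [← RIG.error_eq hpos hωn]
    refine RIG.exists_coupling_triples hn (hp n) (by positivity) (by linarith) ?_ ?_
    · rw [RIG.pHat₂, RIG.choose_two_mul_div (by omega)]
      apply le_of_eq
      ring
    · rw [RIG.pHat₃, RIG.choose_mul_div (by omega)]
      have : 0 < ω n * √(RIG.S₁ n (m n) (p n)) := by positivity
      linarith
  -- Here S₂ ≥ S₁ - K√S₁, so replacing S₁ by S₂ consumes K√S₁ of the slack ω√S₁, and ω - K still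
  -- tends to infinity.
  · obtain ⟨K, hK⟩ := hS₃.bound
    refine RIG.couplingConclusion_of_eventually
      (RIG.tendsto_const_div_sq (tendsto_atTop_add_const_right _ (-K) hω) 288) ?_
    filter_upwards [hS₁.eventually_ge_atTop 5, hω.eventually_gt_atTop K,
      eventually_ge_atTop 3, hK] with n hSn hωn hn hK
    have h30 := RIG.S₃_nonneg (show n ≠ 0 by omega) (hp n)
    have h1 := RIG.S₁_eq_add (n := n) (m := m n) (p := p n)
    rw [Real.norm_of_nonneg (Real.sqrt_nonneg _), Real.norm_of_nonneg h30] at hK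
    have hpos : 0 < RIG.S₁ n (m n) (p n) := by linarith
    have hw : 0 < ω n + -K := by linarith
    rw [← RIG.error_eq hpos hw]
    refine RIG.exists_coupling_pairs hn (hp n) (by positivity) hSn (by linarith) le_rfl ?_
    rw [RIG.pHat, RIG.choose_two_mul_div (by omega), mul_div_assoc]
    linarith
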